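/- Let $C$ be a smooth complete (irreducible) curve over $\mathbb{C}$ and $f : C \to \mathbb{P}^1$ a morphism of prime degree $d$ that is Galois with group $\mathbb{Z}/d\mathbb{Z}$, this group being normal in $\operatorname{Aut}(C)$ (so $C$ is a cyclic curve of degree $d$). Assume that $f$ is unramified over $\infty \in \mathbb{P}^1$, and let $x_1, \dots, x_r$ be the distinct ramification points of $f$ on $C$; there are finitely many of them and $r \ge 2$. Let $J(C)$ be the Jacobian of $C$ (divisors of degree $0$ modulo principal divisors) and $J(C)[d]$ its subgroup of points killed by $d$. Then every divisor $\sum_{i=1}^r n_i x_i$ with $n_i \in \mathbb{Z}$ and $\sum_{i=1}^r n_i = 0$ represents a point of $J(C)[d]$, and exactly $d^{\,r-2}$ points of $J(C)[d]$ (the point $0$ included) are represented by such divisors. -/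

import Mathlib

open scoped IntermediateField WithZero

noncomputable section

/-- A field `K ⊇ ℂ` is the function field of an (irreducible) complex algebraic curve if it is
finitely generated and of transcendence degree one over `ℂ`.  Such a field determines the smooth
complete curve `C` with function field `K`, and conversely. -/
class IsCurveFunctionField (K : Type*) [Field K] [Algebra ℂ K] : Prop where
  fg : (⊤ : IntermediateField ℂ K).FG
  trdeg_eq_one : Algebra.trdeg ℂ K = 1

/-- A point of the smooth complete curve with function field `K`: a discrete valuation ring with
fraction field `K` that contains the constants (the local ring of the curve at the point). -/
@[ext]
structure CurvePoint (K : Type*) [Field K] [Algebra ℂ K] where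
  /-- The local ring at the point. -/
  localRing : ValuationSubring K
  constants_mem : ∀ c : ℂ, algebraMap ℂ K c ∈ localRing
  isDVR : IsDiscreteValuationRing localRing

attribute [instance] CurvePoint.isDVR

namespace CurvePoint

variable {K : Type*} [Field K] [Algebra ℂ K]

/-- The multiplicative discrete valuation of `K` at a point. -/
def valuation (P : CurvePoint K) : Valuation K ℤᵐ⁰ :=
  (IsDiscreteValuationRing.maximalIdeal P.localRing).valuation K

/-- The order of vanishing of a nonzero rational function at a point: positive at a zero, negative
at a pole.  (For `h = 0` the value is `0`, and it is never used.) -/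
def ord (P : CurvePoint K) (h : K) : ℤ :=
  -WithZero.log (P.valuation h)

theorem ord_one (P : CurvePoint K) : P.ord 1 = 0 := by
  simp [ord]

theorem ord_mul (P : CurvePoint K) {g h : K} (hg : g ≠ 0) (hh : h ≠ 0) :
    P.ord (g * h) = P.ord g + P.ord h := by
  have hg' : P.valuation g ≠ 0 := (Valuation.ne_zero_iff _).2 hg
  have hh' : P.valuation h ≠ 0 := (Valuation.ne_zero_iff _).2 hh
  simp only [ord, map_mul, WithZero.log_mul hg' hh']
  ring

theorem ord_inv (P : CurvePoint K) (h : K) : P.ord h⁻¹ = -P.ord h := by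
  simp [ord, map_inv₀, WithZero.log_inv]

/-- A nonconstant rational function `f`, viewed as a morphism to the projective line, has its value
at `P` equal to infinity when `f` has a pole at `P`. -/
def LiesOverInfinity (f : K) (P : CurvePoint K) : Prop :=
  P.ord f < 0

/-- The ramification index at `P` of the morphism to the projective line given by a nonconstant
rational function `f` is at least two.  The index is the order of vanishing at `P` of the pullback
of a local parameter at `f(P)`: this is `f - c` if `f(P) = c` is finite, and `1 / f` if `f(P)` is
infinity.  (If `c ≠ f(P)`, then `f - c` has order `≤ 0` at `P`.) -/
def IsRamified (f : K) (P : CurvePoint K) : Prop :=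
  (∃ c : ℂ, 2 ≤ P.ord (f - algebraMap ℂ K c)) ∨ 2 ≤ P.ord f⁻¹

end CurvePoint

/-- `f`, viewed as a morphism from the smooth complete curve `C` with function field `K` to the
projective line, makes `C` a cyclic curve of degree `d`: the morphism is nonconstant of degree `d`,
it is Galois with cyclic Galois group, and that group is normal in the automorphism group of `C`
(which is the automorphism group of `K` over `ℂ`). -/
structure IsCyclicCurve {K : Type*} [Field K] [Algebra ℂ K] (d : ℕ) (f : K) : Prop where
  transcendental : Transcendental ℂ f
  degree_eq : Module.finrank ℂ⟮f⟯ K = d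
  isGalois : IsGalois ℂ⟮f⟯ K
  isCyclic : IsCyclic (K ≃ₐ[ℂ⟮f⟯] K)
  normal : (ℂ⟮f⟯.fixingSubgroup : Subgroup (K ≃ₐ[ℂ] K)).Normal

section Jacobian

variable (K : Type*) [Field K] [Algebra ℂ K]

/-- Divisors on the curve. -/
abbrev CurveDivisor : Type _ := CurvePoint K →₀ ℤ

/-- The principal divisors: those of the form `∑ ord_P(h) P` for some nonzero `h`. -/
def principalDivisors : AddSubgroup (CurveDivisor K) where
  carrier := {D | ∃ h : K, h ≠ 0 ∧ ∀ P, D P = P.ord h}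
  zero_mem' := ⟨1, one_ne_zero, fun P => by simp [CurvePoint.ord_one]⟩
  add_mem' := by
    rintro D E ⟨g, hg, hD⟩ ⟨h, hh, hE⟩
    exact ⟨g * h, mul_ne_zero hg hh, fun P => by
      rw [Finsupp.add_apply, hD, hE, P.ord_mul hg hh]⟩
  neg_mem' := by
    rintro D ⟨h, hh, hD⟩
    exact ⟨h⁻¹, inv_ne_zero hh, fun P => by rw [Finsupp.neg_apply, hD, P.ord_inv]⟩

/-- The group of divisors of degree zero, the degree of `∑ nᵢ Pᵢ` being `∑ nᵢ`. -/
def divisorsDegZero : AddSubgroup (CurveDivisor K) :=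
  (Finsupp.degree : CurveDivisor K →+ ℤ).ker

/-- The group of (complex) points of the Jacobian of the curve: divisors of degree zero modulo
principal divisors. -/
abbrev CurveJacobian : Type _ :=
  divisorsDegZero K ⧸ (principalDivisors K).addSubgroupOf (divisorsDegZero K)

variable {K}

/-- The ramification points of the morphism to the projective line given by `f`. -/
def ramificationPoints (f : K) : Set (CurvePoint K) :=
  {P | P.IsRamified f}

/-- The points of the Jacobian that are represented by a divisor `∑ nᵢ xᵢ` of degree zero supported
on the ramification points `xᵢ` of `f`. -/
def ramificationClasses (f : K) : Set (CurveJacobian K) :=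
  {c | ∃ D : divisorsDegZero K, (↑(D : CurveDivisor K).support ⊆ ramificationPoints f) ∧
    QuotientAddGroup.mk D = c}

end Jacobian

end

/-! By Kummer theory the function field is `ℂ(f, y)` with `y ^ d = g(f)`, where every root `a` of
`g` has multiplicity `m_a` with `0 < m_a < d`. The curve has exactly one point over each root `a`;
there `f - a` has order `d` and `y` has order `m_a`. These are the ramification points. As `f` has
simple poles, `d * ord y = -deg g` at each of them, so `d` divides `∑ m_a = deg g`. This excludes `r
= 1`. If `r = 0`, then `y` is constant and the degree is one.

The heart is `mem_principalDivisors_iff`: a degree-zero divisor `D = ∑ n_a x_a` is principal iff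
`(n_a)` is a multiple of `(m_a)` modulo `d`. The function `F = ∏ (f - a) ^ n_a` has divisor `d D`.
If `D` is the divisor of `w`, then `w ^ d / F` has no zeros, hence is constant. So `w ^ d ∈ ℂ(f)`,
and Kummer theory gives `w = y ^ k * u` with `u ∈ ℂ(f)`, whose orders at the ramification points are
divisible by `d`. Conversely, a congruence modulo `d` is realised by `y ^ k` times a product of
powers of the `f - a`.

Taking `k = 0` shows that `d D` is principal. Reduction modulo `d` identifies the classes with the
hyperplane `∑ v_a = 0` in `(ℤ/d)^r` modulo the line spanned by `(m_a)`, a group of order `d ^ (r -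
1) / d`. -/

open Polynomial

/-! ### Orders, valuations and local rings at a point. -/

namespace CurvePoint

variable {K : Type*} [Field K] [Algebra ℂ K] (P : CurvePoint K)

theorem valuation_eq_exp_neg_ord {h : K} (hh : h ≠ 0) :
    P.valuation h = WithZero.exp (-P.ord h) := by
  rw [ord, neg_neg, WithZero.exp_log ((Valuation.ne_zero_iff _).2 hh)]

theorem valuation_le_one_iff_ord {h : K} (hh : h ≠ 0) : P.valuation h ≤ 1 ↔ 0 ≤ P.ord h := by
  rw [P.valuation_eq_exp_neg_ord hh, ← WithZero.exp_zero, WithZero.exp_le_exp]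
  omega

theorem valuation_lt_one_iff_ord {h : K} (hh : h ≠ 0) : P.valuation h < 1 ↔ 0 < P.ord h := by
  rw [P.valuation_eq_exp_neg_ord hh, ← WithZero.exp_zero, WithZero.exp_lt_exp]
  omega

theorem valuation_eq_one_iff_ord {h : K} (hh : h ≠ 0) : P.valuation h = 1 ↔ P.ord h = 0 := by
  rw [P.valuation_eq_exp_neg_ord hh, ← WithZero.exp_zero, WithZero.exp_inj]
  omega

theorem valuation_le_one_iff_mem (h : K) : P.valuation h ≤ 1 ↔ h ∈ P.localRing := by
  have key : ∀ r : P.localRing, P.valuation (r : K) ≤ 1 := fun r =>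
    (IsDiscreteValuationRing.maximalIdeal P.localRing).valuation_le_one (K := K) r
  refine ⟨fun hv => ?_, fun hm => key ⟨h, hm⟩⟩
  by_contra hm
  have hinv : h⁻¹ ∈ P.localRing := (P.localRing.mem_or_inv_mem h).resolve_left hm
  have h0 : h ≠ 0 := by
    rintro rfl
    exact hm P.localRing.zero_mem
  have hnu : (⟨h⁻¹, hinv⟩ : P.localRing) ∈ IsLocalRing.maximalIdeal P.localRing := by
    rw [IsLocalRing.mem_maximalIdeal, mem_nonunits_iff]
    intro hu
    obtain ⟨u, hu⟩ := hu
    have h1 : ((u⁻¹ : P.localRingˣ) : P.localRing) * (u : P.localRing) = 1 := by simp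
    rw [hu] at h1
    have h2 : (((u⁻¹ : P.localRingˣ) : P.localRing) : K) * h⁻¹ = 1 := by
      simpa using congrArg (Subtype.val) h1
    apply hm
    have : h = (((u⁻¹ : P.localRingˣ) : P.localRing) : K) := by
      field_simp at h2
      exact h2.symm
    rw [this]
    exact Subtype.property _
  have hlt : P.valuation h⁻¹ < 1 :=
    ((IsDiscreteValuationRing.maximalIdeal P.localRing).valuation_lt_one_iff_mem
      (K := K) ⟨h⁻¹, hinv⟩).2 hnu
  rw [P.valuation_lt_one_iff_ord (inv_ne_zero h0), P.ord_inv] at hlt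
  rw [P.valuation_le_one_iff_ord h0] at hv
  omega

theorem exists_ord_eq_one : ∃ t : K, t ≠ 0 ∧ P.ord t = 1 := by
  obtain ⟨t, ht⟩ :=
    (IsDiscreteValuationRing.maximalIdeal P.localRing).valuation_exists_uniformizer K
  have ht' : P.valuation t = WithZero.exp (-1 : ℤ) := ht
  refine ⟨t, ?_, by rw [ord, ht', WithZero.log_exp, neg_neg]⟩
  rintro rfl
  rw [map_zero] at ht'
  exact WithZero.exp_ne_zero ht'.symm

theorem eq_of_ord_eq {P Q : CurvePoint K} (h : ∀ x : K, x ≠ 0 → P.ord x = Q.ord x) : P = Q := by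
  ext x
  rw [← P.valuation_le_one_iff_mem, ← Q.valuation_le_one_iff_mem]
  rcases eq_or_ne x 0 with rfl | hx
  · simp
  · rw [P.valuation_le_one_iff_ord hx, Q.valuation_le_one_iff_ord hx, h x hx]

theorem valuation_algebraMap_le_one (c : ℂ) : P.valuation (algebraMap ℂ K c) ≤ 1 :=
  (P.valuation_le_one_iff_mem _).2 (P.constants_mem c)

theorem ord_algebraMap (c : ℂ) : P.ord (algebraMap ℂ K c) = 0 := by
  rcases eq_or_ne c 0 with rfl | hc
  · simp [ord]
  · have hc' : algebraMap ℂ K c ≠ 0 := by simpa using hc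
    have h1 := (P.valuation_le_one_iff_ord hc').1 (P.valuation_algebraMap_le_one c)
    have h2 := P.valuation_algebraMap_le_one c⁻¹
    rw [map_inv₀, P.valuation_le_one_iff_ord (inv_ne_zero hc'), P.ord_inv] at h2
    omega

theorem valuation_algebraMap {c : ℂ} (hc : c ≠ 0) : P.valuation (algebraMap ℂ K c) = 1 :=
  (P.valuation_eq_one_iff_ord (by simpa using hc)).2 (P.ord_algebraMap c)

theorem ord_pow {h : K} (hh : h ≠ 0) (n : ℕ) : P.ord (h ^ n) = n * P.ord h := by
  induction n with
  | zero => simp [P.ord_one]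
  | succ n ih => rw [pow_succ, P.ord_mul (pow_ne_zero _ hh) hh, ih]; push_cast; ring

theorem ord_zpow {h : K} (hh : h ≠ 0) (n : ℤ) : P.ord (h ^ n) = n * P.ord h := by
  cases n with
  | ofNat n => simpa using P.ord_pow hh n
  | negSucc n =>
    rw [zpow_negSucc, P.ord_inv, P.ord_pow hh, Int.negSucc_eq]
    push_cast
    ring

theorem ord_div {g h : K} (hg : g ≠ 0) (hh : h ≠ 0) : P.ord (g / h) = P.ord g - P.ord h := by
  rw [div_eq_mul_inv, P.ord_mul hg (inv_ne_zero hh), P.ord_inv, sub_eq_add_neg]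

theorem ord_prod {ι : Type*} (s : Finset ι) (F : ι → K) (hF : ∀ i ∈ s, F i ≠ 0) :
    P.ord (∏ i ∈ s, F i) = ∑ i ∈ s, P.ord (F i) := by
  classical
  induction s using Finset.induction_on with
  | empty => simp [P.ord_one]
  | insert a s ha ih =>
    rw [Finset.prod_insert ha, Finset.sum_insert ha, P.ord_mul (hF a (by simp))
      (Finset.prod_ne_zero_iff.2 fun i hi => hF i (by simp [hi])),
      ih fun i hi => hF i (by simp [hi])]

end CurvePoint

theorem Transcendental.aeval_ne_zero {K : Type*} [Field K] [Algebra ℂ K] {f : K}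
    (hf : Transcendental ℂ f) {p : ℂ[X]} (hp : p ≠ 0) :
    Polynomial.aeval f p ≠ 0 :=
  fun h => hf ⟨p, hp, h⟩

theorem Transcendental.sub_algebraMap_ne_zero {K : Type*} [Field K] [Algebra ℂ K] {f : K}
    (hf : Transcendental ℂ f) (c : ℂ) : f - algebraMap ℂ K c ≠ 0 := by
  simpa using hf.aeval_ne_zero (X_sub_C_ne_zero c)

/-! ### Orders of polynomials in `f`. -/

namespace CurvePoint

variable {K : Type*} [Field K] [Algebra ℂ K] (P : CurvePoint K) {f : K}

/-- Over `ℂ` the polynomial splits, and its leading coefficient has order zero. -/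
theorem ord_aeval (hf : Transcendental ℂ f) {p : ℂ[X]} (hp : p ≠ 0) :
    P.ord (aeval f p) = (p.roots.map fun a => P.ord (f - algebraMap ℂ K a)).sum := by
  have hs : ∀ s : Multiset ℂ, P.ord (aeval f (s.map fun a => X - C a).prod) =
      (s.map fun a => P.ord (f - algebraMap ℂ K a)).sum := by
    intro s
    induction s using Multiset.induction_on with
    | empty => simp [P.ord_one]
    | cons a s ih =>
      rw [Multiset.map_cons, Multiset.prod_cons, map_mul, P.ord_mul
        (hf.aeval_ne_zero (X_sub_C_ne_zero a)), ih, Multiset.map_cons, Multiset.sum_cons]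
      · simp
      · refine hf.aeval_ne_zero (Multiset.prod_ne_zero ?_)
        simp [X_sub_C_ne_zero]
  conv_lhs => rw [(IsAlgClosed.splits p).eq_prod_roots]
  rw [map_mul, P.ord_mul _ _, hs, aeval_C, P.ord_algebraMap, zero_add]
  · exact hf.aeval_ne_zero (by simpa using hp)
  · refine hf.aeval_ne_zero (Multiset.prod_ne_zero ?_)
    simp [X_sub_C_ne_zero]

theorem ord_sub_algebraMap_of_pole (hP : P.ord f < 0) (c : ℂ) :
    P.ord (f - algebraMap ℂ K c) = P.ord f := by
  have hf : f ≠ 0 := by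
    rintro rfl
    simp [ord] at hP
  have h1 : 1 < P.valuation f := by
    rw [P.valuation_eq_exp_neg_ord hf, ← WithZero.exp_zero, WithZero.exp_lt_exp]
    omega
  have h2 : P.valuation (f - algebraMap ℂ K c) = P.valuation f :=
    Valuation.map_sub_eq_of_lt_left _ ((P.valuation_algebraMap_le_one c).trans_lt h1)
  rw [ord, h2, ord]

theorem valuation_sub_algebraMap_of_zero {c : ℂ} {h : K}
    (hc : P.valuation (h - algebraMap ℂ K c) < 1) {a : ℂ} (ha : a ≠ c) :
    P.valuation (h - algebraMap ℂ K a) = 1 := by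
  have h1 : h - algebraMap ℂ K a = (h - algebraMap ℂ K c) + algebraMap ℂ K (c - a) := by
    rw [map_sub]; ring
  have h2 := P.valuation_algebraMap (sub_ne_zero.2 ha.symm)
  rw [h1, Valuation.map_add_eq_of_lt_right _ (by rwa [h2]), h2]

theorem ord_sub_algebraMap_of_zero (hf : Transcendental ℂ f) {c : ℂ}
    (hc : 0 < P.ord (f - algebraMap ℂ K c)) {a : ℂ} (ha : a ≠ c) :
    P.ord (f - algebraMap ℂ K a) = 0 := by
  rw [← P.valuation_eq_one_iff_ord (hf.sub_algebraMap_ne_zero a)]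
  exact P.valuation_sub_algebraMap_of_zero
    ((P.valuation_lt_one_iff_ord (hf.sub_algebraMap_ne_zero c)).2 hc) ha

theorem ord_aeval_of_pole (hf : Transcendental ℂ f) (hP : P.ord f < 0) {p : ℂ[X]} (hp : p ≠ 0) :
    P.ord (aeval f p) = p.natDegree * P.ord f := by
  simp [P.ord_aeval hf hp, P.ord_sub_algebraMap_of_pole hP,
    splits_iff_card_roots.1 (IsAlgClosed.splits p)]

theorem ord_aeval_of_zero (hf : Transcendental ℂ f) {c : ℂ}
    (hc : 0 < P.ord (f - algebraMap ℂ K c)) {p : ℂ[X]} (hp : p ≠ 0) :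
    P.ord (aeval f p) = p.rootMultiplicity c * P.ord (f - algebraMap ℂ K c) := by
  classical
  rw [P.ord_aeval hf hp, Finset.sum_multiset_map_count]
  rw [Finset.sum_eq_single c]
  · simp
  · intro a _ ha
    simp [P.ord_sub_algebraMap_of_zero hf hc ha]
  · intro h
    have : ¬ p.IsRoot c := by simpa [hp] using h
    simp [rootMultiplicity_eq_zero this]

/-- Every point lies over infinity or over a finite point of the projective line. -/
theorem pole_or_exists_zero (hf : Transcendental ℂ f) [Algebra.IsAlgebraic ℂ⟮f⟯ K] :
    P.ord f < 0 ∨ ∃ c : ℂ, 0 < P.ord (f - algebraMap ℂ K c) := by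
  -- Otherwise every nonzero element of `ℂ(f)` has order zero. The local ring then contains `ℂ(f)`
  -- and, being integrally closed, all of `K`, so the inverse of a uniformizer lies in it.
  by_contra! hcon
  obtain ⟨h0, hneg⟩ := hcon
  have hf0 : f ≠ 0 := by simpa using hf.sub_algebraMap_ne_zero 0
  have hzero : ∀ c : ℂ, P.ord (f - algebraMap ℂ K c) = 0 := by
    intro c
    refine le_antisymm (hneg c) ?_
    rw [← P.valuation_le_one_iff_ord (hf.sub_algebraMap_ne_zero c)]
    exact Valuation.map_sub_le _ ((P.valuation_le_one_iff_ord hf0).2 h0)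
      (P.valuation_algebraMap_le_one c)
  have hp : ∀ p : ℂ[X], p ≠ 0 → P.ord (aeval f p) = 0 := by
    intro p hp
    simp [P.ord_aeval hf hp, hzero]
  have hbase : ∀ u ∈ ℂ⟮f⟯, u ∈ P.localRing := by
    intro u hu
    rcases eq_or_ne u 0 with rfl | hu0
    · exact P.localRing.zero_mem
    obtain ⟨r, s, rfl⟩ := (IntermediateField.mem_adjoin_simple_iff ℂ u).1 hu
    have hr : r ≠ 0 := by rintro rfl; simp at hu0
    have hs : s ≠ 0 := by rintro rfl; simp at hu0
    rw [← P.valuation_le_one_iff_mem, P.valuation_le_one_iff_ord hu0,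
      P.ord_div (hf.aeval_ne_zero hr) (hf.aeval_ne_zero hs), hp r hr, hp s hs, sub_zero]
  have hall : ∀ x : K, x ∈ P.localRing := by
    intro x
    have hx : IsIntegral ℂ⟮f⟯ x := (Algebra.IsAlgebraic.isAlgebraic x).isIntegral
    obtain ⟨p, hpm, hpx⟩ := hx
    let φ : ℂ⟮f⟯ →+* P.localRing :=
      (algebraMap ℂ⟮f⟯ K).codRestrict P.localRing.toSubring fun u => hbase _ u.2
    have hx' : IsIntegral P.localRing x := by
      refine ⟨p.map φ, hpm.map φ, ?_⟩
      rw [eval₂_map]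
      exact hpx
    obtain ⟨z, hz⟩ := IsIntegrallyClosed.isIntegral_iff.1 hx'
    rw [← hz]
    exact z.2
  obtain ⟨t, ht, ht1⟩ := P.exists_ord_eq_one
  have := hall t⁻¹
  rw [← P.valuation_le_one_iff_mem, P.valuation_le_one_iff_ord (inv_ne_zero ht), P.ord_inv] at this
  omega

end CurvePoint

/-! ### Existence of zeros of nonconstant functions. -/

section Existence

variable {K : Type*} [Field K] [Algebra ℂ K]

/-- In transcendence degree one, `h` alone is a transcendence basis; algebraic and finitely
generated then give finite. -/
theorem IsCurveFunctionField.finiteDimensional_adjoin [hK : IsCurveFunctionField K] {h : K}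
    (hh : Transcendental ℂ h) : FiniteDimensional ℂ⟮h⟯ K := by
  have hind : AlgebraicIndependent ℂ fun _ : Unit => h :=
    algebraicIndependent_unique_type_iff.2 hh
  have hbasis : IsTranscendenceBasis ℂ fun _ : Unit => h :=
    hind.isTranscendenceBasis_of_lift_trdeg_le_of_finite (by simp [hK.trdeg_eq_one])
  have halg : Algebra.IsAlgebraic ℂ⟮h⟯ K := by
    have := hbasis.isAlgebraic_field
    rwa [Set.range_const] at this
  obtain ⟨S, hS⟩ := hK.fg
  have htop : IntermediateField.adjoin ℂ⟮h⟯ (S : Set K) = ⊤ := by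
    rw [← IntermediateField.restrictScalars_eq_top_iff (K := ℂ), eq_top_iff, ← hS,
      IntermediateField.adjoin_le_iff]
    intro x hx
    exact IntermediateField.subset_adjoin ℂ⟮h⟯ (S : Set K) hx
  have hfin : FiniteDimensional ℂ⟮h⟯ (IntermediateField.adjoin ℂ⟮h⟯ (S : Set K)) :=
    IntermediateField.finiteDimensional_adjoin fun x _ =>
      (Algebra.IsAlgebraic.isAlgebraic x).isIntegral
  rw [htop] at hfin
  exact Module.Finite.equiv (IntermediateField.topEquiv (F := ℂ⟮h⟯) (E := K)).toLinearEquiv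

/-- A height one prime of a Dedekind domain containing the constants gives a point. -/
noncomputable def CurvePoint.ofHeightOneSpectrum {A : Type*} [CommRing A] [IsDedekindDomain A] [Algebra ℂ A]
    [Algebra A K] [IsScalarTower ℂ A K] [IsFractionRing A K]
    (v : IsDedekindDomain.HeightOneSpectrum A) : CurvePoint K where
  localRing := (v.valuation K).valuationSubring
  constants_mem c := by
    rw [IsScalarTower.algebraMap_apply ℂ A K, Valuation.mem_valuationSubring_iff]
    exact v.valuation_le_one _
  isDVR := inferInstanceAs (IsDiscreteValuationRing (v.valuation K).integer)

open scoped IntermediateField.algebraAdjoinAdjoin in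
-- The integral closure of `ℂ[h]` in `K` is a Dedekind domain; a prime of it lying over a maximal
-- ideal that contains `h` is a zero of `h`.
theorem CurvePoint.exists_ord_pos [IsCurveFunctionField K] {h : K} (hh : Transcendental ℂ h) :
    ∃ P : CurvePoint K, 0 < P.ord h := by
  have hfin := IsCurveFunctionField.finiteDimensional_adjoin hh
  have h0 : h ≠ 0 := by simpa using hh.sub_algebraMap_ne_zero 0
  let A : Subalgebra ℂ K := Algebra.adjoin ℂ {h}
  let φ : ℂ[X] →ₐ[ℂ] A := (aeval (⟨h, Algebra.self_mem_adjoin_singleton ℂ h⟩ : A))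
  have hφ : Function.Surjective φ := by
    rintro ⟨x, hx⟩
    obtain ⟨p, hp⟩ := (Algebra.adjoin_singleton_eq_range_aeval ℂ h).le hx
    refine ⟨p, Subtype.ext ?_⟩
    exact (aeval_algHom_apply A.val _ p).symm.trans hp
  have hPID : IsPrincipalIdealRing A := IsPrincipalIdealRing.of_surjective φ hφ
  have hFrac : IsFractionRing A ℂ⟮h⟯ := inferInstance
  let C := integralClosure A K
  have hC : IsDedekindDomain C := integralClosure.isDedekindDomain A ℂ⟮h⟯ K
  have hCF : IsFractionRing C K := integralClosure.isFractionRing_of_finite_extension ℂ⟮h⟯ K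
  let hA : A := ⟨h, Algebra.self_mem_adjoin_singleton ℂ h⟩
  have hne : Ideal.span {hA} ≠ ⊤ := by
    rw [Ne, Ideal.span_singleton_eq_top]
    intro hu
    obtain ⟨b, hb⟩ := hu.exists_right_inv
    obtain ⟨p, rfl⟩ := hφ b
    have hp : aeval h (X * p - 1 : ℂ[X]) = 0 := by
      have := congrArg A.val hb
      rw [map_mul, map_one] at this
      rw [map_sub, map_mul, aeval_X, map_one, sub_eq_zero, ← this]
      exact congrArg (h * ·) (aeval_algHom_apply A.val hA p)
    refine hh.aeval_ne_zero (p := X * p - 1) ?_ hp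
    intro h1
    have := congrArg (eval 0) h1
    simp at this
  obtain ⟨M, hM, hle⟩ := Ideal.exists_le_maximal _ hne
  have hAM : hA ∈ M := hle (Ideal.mem_span_singleton_self hA)
  obtain ⟨Q, hQ, hQM⟩ := Ideal.exists_ideal_over_maximal_of_isIntegral (S := C) M (by
    have hinj : Function.Injective (algebraMap A C) := fun x y hxy =>
      Subtype.ext (congrArg (fun z : C => (z : K)) hxy)
    rw [(RingHom.injective_iff_ker_eq_bot _).1 hinj]
    exact bot_le)
  have hQh : algebraMap A C hA ∈ Q := by
    rw [← Ideal.mem_comap, hQM]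
    exact hAM
  have hQ0 : Q ≠ ⊥ := by
    rintro rfl
    rw [Ideal.mem_bot] at hQh
    apply h0
    exact congrArg (fun z : C => (z : K)) hQh
  let v : IsDedekindDomain.HeightOneSpectrum C := ⟨Q, hQ.isPrime, hQ0⟩
  have hv : v.valuation K h < 1 := (v.valuation_lt_one_iff_mem (K := K) _).2 hQh
  refine ⟨CurvePoint.ofHeightOneSpectrum v, ?_⟩
  set P : CurvePoint K := CurvePoint.ofHeightOneSpectrum v with hP
  -- `P.ord` comes from the maximal ideal of the local ring and not from `v` itself, so the two are
  -- compared through membership of `h⁻¹` in the valuation ring.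
  by_contra hcon
  have h1 : 0 ≤ P.ord h⁻¹ := by rw [P.ord_inv]; omega
  rw [← P.valuation_le_one_iff_ord (inv_ne_zero h0), P.valuation_le_one_iff_mem] at h1
  have h2 : v.valuation K h⁻¹ ≤ 1 := h1
  rw [map_inv₀] at h2
  have h3 : v.valuation K h ≠ 0 := (Valuation.ne_zero_iff _).2 h0
  exact absurd h2 (not_le.2 ((one_lt_inv₀ (zero_lt_iff.2 h3)).2 hv))

/-- A rational function without zeros is constant. -/
theorem exists_eq_algebraMap_of_ord_nonpos [IsCurveFunctionField K] {h : K}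
    (hh : ∀ P : CurvePoint K, P.ord h ≤ 0) : ∃ c : ℂ, h = algebraMap ℂ K c := by
  by_cases ht : Transcendental ℂ h
  · obtain ⟨P, hP⟩ := CurvePoint.exists_ord_pos ht
    exact absurd (hh P) (not_le.2 hP)
  · have halg : IsAlgebraic ℂ h := by
      rw [Transcendental, not_not] at ht
      exact ht
    have := IntermediateField.isAlgebraic_adjoin_simple halg.isIntegral
    have hbot := IntermediateField.eq_bot_of_isAlgClosed_of_isAlgebraic ℂ⟮h⟯
    obtain ⟨c, hc⟩ := hbot.le (IntermediateField.mem_adjoin_simple_self ℂ h)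
    exact ⟨c, hc.symm⟩

end Existence

/-! ### The coordinate ring `ℂ[t, s]` and local generators at a point. -/

theorem Algebra.exists_eq_add_of_mem_adjoin_pair {K : Type*} [Field K] [Algebra ℂ K] {t s h : K}
    (hh : h ∈ Algebra.adjoin ℂ {t, s}) :
    ∃ c : ℂ, ∃ h₁ ∈ Algebra.adjoin ℂ {t, s}, ∃ h₂ ∈ Algebra.adjoin ℂ {t, s},
      h = algebraMap ℂ K c + t * h₁ + s * h₂ := by
  have h1 := one_mem (Algebra.adjoin ℂ {t, s})
  have h0 := zero_mem (Algebra.adjoin ℂ {t, s})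
  induction hh using Algebra.adjoin_induction with
  | mem x hx =>
    rcases hx with rfl | rfl
    · exact ⟨0, 1, h1, 0, h0, by simp⟩
    · exact ⟨0, 0, h0, 1, h1, by simp⟩
  | algebraMap r => exact ⟨r, 0, h0, 0, h0, by simp⟩
  | add x y hx hy ihx ihy =>
    obtain ⟨c, a, ha, b, hb, rfl⟩ := ihx
    obtain ⟨c', a', ha', b', hb', rfl⟩ := ihy
    exact ⟨c + c', a + a', add_mem ha ha', b + b', add_mem hb hb', by rw [map_add]; ring⟩
  | mul x y hx hy ihx ihy =>
    obtain ⟨c, a, ha, b, hb, rfl⟩ := ihx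
    obtain ⟨c', a', ha', b', hb', rfl⟩ := ihy
    have hc := (Algebra.adjoin ℂ {t, s}).algebraMap_mem c
    refine ⟨c * c', _, add_mem (mul_mem ha hy) (mul_mem hc ha'), _,
      add_mem (mul_mem hb hy) (mul_mem hc hb'), ?_⟩
    rw [map_mul]
    ring

theorem IntermediateField.adjoin_pair_eq_top_of_mem {K : Type*} [Field K] [Algebra ℂ K]
    {f y t s : K} (hgen : IntermediateField.adjoin ℂ {f, y} = ⊤)
    (hf : f ∈ IntermediateField.adjoin ℂ {t, s}) (hy : y ∈ IntermediateField.adjoin ℂ {t, s}) :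
    IntermediateField.adjoin ℂ {t, s} = ⊤ := by
  rw [eq_top_iff, ← hgen, IntermediateField.adjoin_le_iff]
  rintro x (rfl | rfl)
  · exact hf
  · exact hy

theorem IntermediateField.mem_adjoin_of_sub_mem {K : Type*} [Field K] [Algebra ℂ K] {h : K}
    {c : ℂ} {S : Set K} (hS : h - algebraMap ℂ K c ∈ S) : h ∈ IntermediateField.adjoin ℂ S := by
  have := add_mem (IntermediateField.subset_adjoin ℂ S hS) (IntermediateField.algebraMap_mem _ c)
  rwa [sub_add_cancel] at this

theorem Subalgebra.aeval_mem_of_mem {K : Type*} [Field K] [Algebra ℂ K] {S : Subalgebra ℂ K}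
    {h : K} (hh : h ∈ S) (p : ℂ[X]) : aeval h p ∈ S := by
  rw [show h = ((⟨h, hh⟩ : S) : K) from rfl, Subalgebra.aeval_coe]
  exact Subtype.property _

theorem Polynomial.aeval_mem_adjoin_of_sub_mem {K : Type*} [Field K] [Algebra ℂ K] {h : K}
    {c : ℂ} {S : Set K} (hS : h - algebraMap ℂ K c ∈ S) (p : ℂ[X]) :
    aeval h p ∈ Algebra.adjoin ℂ S := by
  have := add_mem (Algebra.subset_adjoin (R := ℂ) hS) ((Algebra.adjoin ℂ S).algebraMap_mem c)
  rw [sub_add_cancel] at this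
  exact Subalgebra.aeval_mem_of_mem this p

namespace CurvePoint

variable {K : Type*} [Field K] [Algebra ℂ K]

theorem valuation_aeval_le_one (P : CurvePoint K) {h : K} (hh : P.valuation h ≤ 1) (p : ℂ[X]) :
    P.valuation (aeval h p) ≤ 1 := by
  induction p using Polynomial.induction_on' with
  | add p q hp hq => rw [map_add]; exact Valuation.map_add_le _ hp hq
  | monomial n a =>
    rw [aeval_monomial, map_mul, map_pow]
    exact mul_le_one' (P.valuation_algebraMap_le_one a) (pow_le_one' hh n)

theorem valuation_le_one_of_sub (P : CurvePoint K) {h : K} {c : ℂ}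
    (hc : P.valuation (h - algebraMap ℂ K c) < 1) : P.valuation h ≤ 1 := by
  have := Valuation.map_add_le _ hc.le (P.valuation_algebraMap_le_one c)
  rwa [sub_add_cancel] at this

/-- Modulo `h - c`, the element `p(h)` is the nonzero constant `p(c)`. -/
theorem valuation_aeval_eq_one (P : CurvePoint K) {h : K} {c : ℂ}
    (hc : P.valuation (h - algebraMap ℂ K c) < 1) {p : ℂ[X]} (hp : p.eval c ≠ 0) :
    P.valuation (aeval h p) = 1 := by
  obtain ⟨q, hq⟩ := X_sub_C_dvd_sub_C_eval (a := c) (p := p)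
  have h1 : aeval h p = (h - algebraMap ℂ K c) * aeval h q + algebraMap ℂ K (p.eval c) := by
    have := congrArg (aeval h) hq
    simp only [map_sub, map_mul, aeval_X, aeval_C] at this
    rw [← this]; ring
  have h2 := P.valuation_algebraMap hp
  rw [h1, Valuation.map_add_eq_of_lt_right _, h2]
  rw [h2, map_mul]
  exact mul_lt_one_of_lt_of_le hc (P.valuation_aeval_le_one (P.valuation_le_one_of_sub hc) q)

/-- `z` generates the maximal ideal of the coordinate ring `ℂ[t, s]` at the common zero `P` of
`t` and `s`, where `t` and `s` generate the function field. -/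
structure IsLocalGenerator (P : CurvePoint K) (t s z : K) : Prop where
  gen : IntermediateField.adjoin ℂ {t, s} = ⊤
  ht : P.valuation t < 1
  hs : P.valuation s < 1
  ne_zero : z ≠ 0
  mem : z ∈ Algebra.adjoin ℂ {t, s}
  pos : P.valuation z < 1
  exists_mul_eq : ∃ u ∈ Algebra.adjoin ℂ {t, s}, P.valuation u = 1 ∧
    (∃ a ∈ Algebra.adjoin ℂ {t, s}, u * t = z * a) ∧
    (∃ b ∈ Algebra.adjoin ℂ {t, s}, u * s = z * b)

namespace IsLocalGenerator

variable {P Q : CurvePoint K} {t s z : K}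

theorem valuation_le_one (hz : P.IsLocalGenerator t s z) {h : K}
    (hh : h ∈ Algebra.adjoin ℂ {t, s}) : P.valuation h ≤ 1 := by
  induction hh using Algebra.adjoin_induction with
  | mem x hx =>
    rcases hx with rfl | rfl
    · exact hz.ht.le
    · exact hz.hs.le
  | algebraMap r => exact P.valuation_algebraMap_le_one r
  | add x y _ _ ihx ihy => exact Valuation.map_add_le _ ihx ihy
  | mul x y _ _ ihx ihy => rw [map_mul]; exact mul_le_one' ihx ihy

theorem valuation_eq_one (hz : P.IsLocalGenerator t s z) {h₁ h₂ : K} {c : ℂ} (hc : c ≠ 0)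
    (hh₁ : h₁ ∈ Algebra.adjoin ℂ {t, s}) (hh₂ : h₂ ∈ Algebra.adjoin ℂ {t, s}) :
    P.valuation (algebraMap ℂ K c + t * h₁ + s * h₂) = 1 := by
  have h1 := P.valuation_algebraMap hc
  have h2 : P.valuation (t * h₁) < 1 := by
    rw [map_mul]
    exact mul_lt_one_of_lt_of_le hz.ht (hz.valuation_le_one hh₁)
  have h3 : P.valuation (s * h₂) < 1 := by
    rw [map_mul]
    exact mul_lt_one_of_lt_of_le hz.hs (hz.valuation_le_one hh₂)
  rw [add_assoc, Valuation.map_add_eq_of_lt_left _, h1]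
  rw [h1]
  exact Valuation.map_add_lt _ h2 h3

theorem ord_pos (hz : P.IsLocalGenerator t s z) : 0 < P.ord z :=
  (P.valuation_lt_one_iff_ord hz.ne_zero).1 hz.pos

theorem exists_div (hz : P.IsLocalGenerator t s z) (x : K) :
    ∃ a ∈ Algebra.adjoin ℂ {t, s}, ∃ b ∈ Algebra.adjoin ℂ {t, s}, a / b = x := by
  have hx : x ∈ IntermediateField.adjoin ℂ {t, s} := by simp [hz.gen]
  obtain ⟨a, ha, b, hb, hab⟩ := IntermediateField.mem_adjoin_iff_div.1 hx
  exact ⟨a, ha, b, hb, hab.symm⟩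

/-- Both `t` and `s` vanish at `P` and at `Q`, so being a unit at either point only depends on the
constant term of `h`. -/
theorem valuation_eq_one_of_valuation_eq_one (hz : P.IsLocalGenerator t s z)
    (hz' : Q.IsLocalGenerator t s z) {h : K} (hh : h ∈ Algebra.adjoin ℂ {t, s})
    (hP : P.valuation h = 1) : Q.valuation h = 1 := by
  obtain ⟨c, h₁, hh₁, h₂, hh₂, rfl⟩ := Algebra.exists_eq_add_of_mem_adjoin_pair hh
  refine hz'.valuation_eq_one ?_ hh₁ hh₂
  rintro rfl
  refine hP.not_lt ?_
  rw [map_zero, zero_add]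
  refine Valuation.map_add_lt _ ?_ ?_
  · rw [map_mul]
    exact mul_lt_one_of_lt_of_le hz.ht (hz.valuation_le_one hh₁)
  · rw [map_mul]
    exact mul_lt_one_of_lt_of_le hz.hs (hz.valuation_le_one hh₂)

/-- Up to units at `P`, every element of the coordinate ring is a power of a local generator. -/
theorem exists_mul_eq_pow_mul (hz : P.IsLocalGenerator t s z) :
    ∀ h ∈ Algebra.adjoin ℂ {t, s}, h ≠ 0 → ∃ n : ℕ,
      ∃ u ∈ Algebra.adjoin ℂ {t, s}, P.valuation u = 1 ∧
      ∃ w ∈ Algebra.adjoin ℂ {t, s}, P.valuation w = 1 ∧ u * h = z ^ n * w := by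
  obtain ⟨u, hu, hu1, ⟨a, ha, hat⟩, ⟨b, hb, hbs⟩⟩ := hz.exists_mul_eq
  have hu0 : u ≠ 0 := by
    rintro rfl
    simp at hu1
  -- Induction on a bound for the order. If the constant term of `h` is nonzero, `h` is a unit at
  -- `P`; otherwise `h` lies in the ideal `(t, s)`, so `u * h` is divisible by `z`, and the quotient
  -- has smaller order.
  have key : ∀ n : ℕ, ∀ h ∈ Algebra.adjoin ℂ {t, s}, h ≠ 0 → P.ord h < n → ∃ n : ℕ,
      ∃ u ∈ Algebra.adjoin ℂ {t, s}, P.valuation u = 1 ∧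
      ∃ w ∈ Algebra.adjoin ℂ {t, s}, P.valuation w = 1 ∧ u * h = z ^ n * w := by
    intro n
    induction n with
    | zero =>
      intro h hh h0 hle
      have := (P.valuation_le_one_iff_ord h0).1 (hz.valuation_le_one hh)
      simp only [Nat.cast_zero] at hle
      omega
    | succ n ih =>
      intro h hh h0 hle
      obtain ⟨c, h₁, hh₁, h₂, hh₂, hc'⟩ := Algebra.exists_eq_add_of_mem_adjoin_pair hh
      by_cases hc : c = 0
      · rw [hc, map_zero, zero_add] at hc'
        have heq : u * h = z * (a * h₁ + b * h₂) := by
          rw [hc', mul_add, ← mul_assoc, hat, ← mul_assoc, hbs]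
          ring
        have hk0 : a * h₁ + b * h₂ ≠ 0 := by
          intro hk
          rw [hk, mul_zero] at heq
          exact mul_ne_zero hu0 h0 heq
        have hP := congrArg P.ord heq
        rw [P.ord_mul hu0 h0, P.ord_mul hz.ne_zero hk0,
          (P.valuation_eq_one_iff_ord hu0).1 hu1, zero_add] at hP
        have hpos := hz.ord_pos
        obtain ⟨m, v, hv, hv1, w, hw, hw1, hvw⟩ :=
          ih _ (add_mem (mul_mem ha hh₁) (mul_mem hb hh₂)) hk0 (by push_cast at hle; omega)
        refine ⟨m + 1, v * u, mul_mem hv hu, by rw [map_mul, hv1, hu1, one_mul], w, hw, hw1, ?_⟩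
        rw [mul_assoc, heq, mul_left_comm, hvw, pow_succ']
        ring
      · refine ⟨0, 1, one_mem _, map_one _, h, hh, ?_, by rw [pow_zero]⟩
        rw [hc']
        exact hz.valuation_eq_one hc hh₁ hh₂
  intro h hh h0
  exact key ((P.ord h).toNat + 1) h hh h0 (Int.lt_add_one_of_le (Int.self_le_toNat _))

theorem ord_eq_of_mul_eq {u h w : K} {n : ℕ} (hz : z ≠ 0) (h0 : h ≠ 0) (hu : P.valuation u = 1)
    (hw : P.valuation w = 1) (heq : u * h = z ^ n * w) : P.ord h = n * P.ord z := by
  have hu0 : u ≠ 0 := by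
    rintro rfl
    simp at hu
  have hw0 : w ≠ 0 := by
    rintro rfl
    simp at hw
  have := congrArg P.ord heq
  rwa [P.ord_mul hu0 h0, P.ord_mul (pow_ne_zero n hz) hw0, P.ord_pow hz,
    (P.valuation_eq_one_iff_ord hu0).1 hu, (P.valuation_eq_one_iff_ord hw0).1 hw, zero_add,
    add_zero] at this

/-- All orders are multiples of that of `z`, and the order one occurs. -/
theorem ord_eq_one (hz : P.IsLocalGenerator t s z) : P.ord z = 1 := by
  have key : ∀ h ∈ Algebra.adjoin ℂ {t, s}, h ≠ 0 → P.ord z ∣ P.ord h := by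
    intro h hh h0
    obtain ⟨n, u, -, hu, w, -, hw, heq⟩ := hz.exists_mul_eq_pow_mul h hh h0
    exact ⟨n, by rw [ord_eq_of_mul_eq hz.ne_zero h0 hu hw heq, mul_comm]⟩
  obtain ⟨x, hx, hx1⟩ := P.exists_ord_eq_one
  obtain ⟨a, ha, b, hb, rfl⟩ := hz.exists_div x
  have ha0 : a ≠ 0 := by rintro rfl; simp at hx
  have hb0 : b ≠ 0 := by rintro rfl; simp at hx
  rw [P.ord_div ha0 hb0] at hx1
  have h1 := dvd_sub (key a ha ha0) (key b hb hb0)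
  rw [hx1] at h1
  exact Int.eq_one_of_dvd_one hz.ord_pos.le h1

/-- The factorization `u * h = z ^ n * w` found at `P` also computes the order at `Q`, as units at
`P` are units at `Q`. -/
theorem eq (hz : P.IsLocalGenerator t s z) (hz' : Q.IsLocalGenerator t s z) : P = Q := by
  have key : ∀ h ∈ Algebra.adjoin ℂ {t, s}, h ≠ 0 → P.ord h = Q.ord h := by
    intro h hh h0
    obtain ⟨n, u, hu, hu1, w, hw, hw1, heq⟩ := hz.exists_mul_eq_pow_mul h hh h0
    rw [ord_eq_of_mul_eq hz.ne_zero h0 hu1 hw1 heq, ord_eq_of_mul_eq hz.ne_zero h0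
      (hz.valuation_eq_one_of_valuation_eq_one hz' hu hu1)
      (hz.valuation_eq_one_of_valuation_eq_one hz' hw hw1) heq, hz.ord_eq_one, hz'.ord_eq_one]
  refine eq_of_ord_eq fun x hx => ?_
  obtain ⟨a, ha, b, hb, rfl⟩ := hz.exists_div x
  have ha0 : a ≠ 0 := by rintro rfl; simp at hx
  have hb0 : b ≠ 0 := by rintro rfl; simp at hx
  rw [P.ord_div ha0 hb0, Q.ord_div ha0 hb0, key a ha ha0, key b hb hb0]

end IsLocalGenerator

/-! ### Local parameters on `y ^ d = g(f)`. -/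

variable {f y : K} {d : ℕ} {g : ℂ[X]}

/-- The value `β` of `y` at `P` is a simple root of `Y ^ d - g(c)`, so `y - β` is a multiple of `f -
c` up to a unit at `P`, and `f - c` is a local parameter. -/
theorem ord_sub_of_not_isRoot {P : CurvePoint K} (hf : Transcendental ℂ f) (hd : d ≠ 0)
    (hgen : IntermediateField.adjoin ℂ {f, y} = ⊤) (hy : y ^ d = aeval f g) {c : ℂ}
    (hg : g.eval c ≠ 0) (hc : 0 < P.ord (f - algebraMap ℂ K c)) :
    P.ord (f - algebraMap ℂ K c) = 1 := by
  have hc' := (P.valuation_lt_one_iff_ord (hf.sub_algebraMap_ne_zero c)).2 hc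
  have hgf : P.valuation (aeval f g) = 1 := P.valuation_aeval_eq_one hc' hg
  have hy1 : P.valuation y ≤ 1 := by
    rw [← hy, map_pow] at hgf
    exact ((pow_eq_one_iff_of_nonneg zero_le hd).1 hgf).le
  obtain ⟨G, hG⟩ := X_sub_C_dvd_sub_C_eval (a := c) (p := g)
  have hG' : y ^ d - algebraMap ℂ K (g.eval c) = (f - algebraMap ℂ K c) * aeval f G := by
    simpa [hy] using congrArg (aeval f) hG
  -- The product of all `y - β` with `β ^ d = g(c)` vanishes at `P`, so some factor does.
  obtain ⟨β, hβ, hyβ⟩ : ∃ β : ℂ, β ^ d = g.eval c ∧ P.valuation (y - algebraMap ℂ K β) < 1 := by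
    by_contra! hcon
    let r : ℂ[X] := X ^ d - C (g.eval c)
    have hr : r.Monic := monic_X_pow_sub_C _ hd
    have h1 : P.valuation (aeval y r) < 1 := by
      simp only [r, map_sub, map_pow, aeval_X, aeval_C, hG', map_mul]
      exact mul_lt_one_of_lt_of_le hc'
        (P.valuation_aeval_le_one (P.valuation_le_one_of_sub hc') G)
    refine h1.ne ?_
    rw [(IsAlgClosed.splits r).eq_prod_roots, hr.leadingCoeff, C_1, one_mul, map_multiset_prod,
      map_multiset_prod, Multiset.map_map, Multiset.map_map]
    refine Multiset.prod_eq_one fun x hx => ?_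
    obtain ⟨β, hβ, rfl⟩ := Multiset.mem_map.1 hx
    have hβ' : β ^ d = g.eval c := by
      have := (mem_roots hr.ne_zero).1 hβ
      simpa [r, sub_eq_zero] using this
    simp only [Function.comp_apply, map_sub, aeval_X, aeval_C]
    exact le_antisymm (Valuation.map_sub_le _ hy1 (P.valuation_algebraMap_le_one β)) (hcon β hβ')
  have hβ0 : β ≠ 0 := by
    rintro rfl
    rw [zero_pow hd] at hβ
    exact hg hβ.symm
  obtain ⟨r, hr⟩ : X - C β ∣ (X ^ d - C (g.eval c) : ℂ[X]) := by
    rw [dvd_iff_isRoot]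
    simp [hβ]
  -- `r(β)` is the derivative of `Y ^ d - g(c)` at `β`, namely `d * β ^ (d - 1)`.
  have hrβ : r.eval β ≠ 0 := by
    have := congrArg (fun p => eval β (derivative p)) hr
    simp only [derivative_sub, derivative_X_pow, derivative_C, sub_zero, eval_mul, eval_C,
      eval_pow, eval_X, derivative_mul, derivative_X, one_mul, eval_add, eval_sub, sub_self,
      zero_mul, add_zero] at this
    rw [← this]
    exact mul_ne_zero (Nat.cast_ne_zero.2 hd) (pow_ne_zero _ hβ0)
  have hry : y ^ d - algebraMap ℂ K (g.eval c) = (y - algebraMap ℂ K β) * aeval y r := by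
    simpa using congrArg (aeval y) hr
  have hz : P.IsLocalGenerator (f - algebraMap ℂ K c) (y - algebraMap ℂ K β)
      (f - algebraMap ℂ K c) := by
    refine ⟨IntermediateField.adjoin_pair_eq_top_of_mem hgen ?_ ?_, hc', hyβ,
      hf.sub_algebraMap_ne_zero c, Algebra.subset_adjoin (by simp), hc', aeval y r,
      aeval_mem_adjoin_of_sub_mem (c := β) (by simp) r, P.valuation_aeval_eq_one hyβ hrβ,
      ⟨aeval y r, aeval_mem_adjoin_of_sub_mem (c := β) (by simp) r, mul_comm _ _⟩,
      ⟨aeval f G, aeval_mem_adjoin_of_sub_mem (c := c) (by simp) G, by rw [mul_comm, ← hry, hG']⟩⟩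
    · exact IntermediateField.mem_adjoin_of_sub_mem (c := c) (by simp)
    · exact IntermediateField.mem_adjoin_of_sub_mem (c := β) (by simp)
  exact hz.ord_eq_one

/-- Over a root of `g` of multiplicity prime to `d`, the covering `y ^ d = g(f)` has a common local
generator for all points. -/
theorem exists_isLocalGenerator (hf : Transcendental ℂ f) (hd : 1 < d)
    (hgen : IntermediateField.adjoin ℂ {f, y} = ⊤) (hy : y ^ d = aeval f g) (hg : g ≠ 0) {a : ℂ}
    (hcop : (g.rootMultiplicity a).Coprime d) :
    ∃ z : K, ∀ P : CurvePoint K, 0 < P.ord (f - algebraMap ℂ K a) →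
      P.IsLocalGenerator (f - algebraMap ℂ K a) z z ∧
      P.ord (f - algebraMap ℂ K a) = d * P.ord z := by
  have hd0 : d ≠ 0 := by omega
  have hx0 := hf.sub_algebraMap_ne_zero a
  have hgf0 := hf.aeval_ne_zero hg
  have hy0 : y ≠ 0 := by
    rintro rfl
    rw [zero_pow hd0] at hy
    exact hgf0 hy.symm
  set m := g.rootMultiplicity a with hm
  obtain ⟨q, hgq, hq⟩ := exists_eq_pow_rootMultiplicity_mul_and_not_dvd g hg a
  rw [← hm] at hgq
  rw [dvd_iff_isRoot] at hq
  -- With `m * A = 1 + d * k`, the function `z = y ^ A / x ^ k` satisfies `z ^ d = x * q(f) ^ A`,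
  -- where `q(a) ≠ 0`: a `d`-th root of `x` up to a unit. It is chosen before any point over `a`.
  obtain ⟨A, hA⟩ := Nat.exists_mul_mod_eq_one_of_coprime hcop hd
  set k := m * A / d with hk
  have hAk : m * A = 1 + d * k := by
    rw [← hA.2, add_comm, hk, Nat.div_add_mod]
  set x := f - algebraMap ℂ K a with hx
  have hgf : aeval f g = x ^ m * aeval f q := by
    rw [hgq]
    simp [hx]
  set z := y ^ A / x ^ k with hz
  have hz0 : z ≠ 0 := div_ne_zero (pow_ne_zero _ hy0) (pow_ne_zero _ hx0)
  have hzd : z ^ d = x * aeval f (q ^ A) := by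
    rw [hz, div_pow, ← pow_mul, ← pow_mul, mul_comm A d, pow_mul, hy, hgf, mul_pow, ← pow_mul, hAk,
      mul_comm k d, map_pow]
    field_simp
    ring
  -- This recovers `y` from `x` and `z`, so these two generate the function field.
  have hyz : y = z ^ m * x ^ (k * m) / aeval f g ^ k := by
    rw [eq_div_iff (pow_ne_zero _ hgf0), ← hy, hz, div_pow, ← pow_mul, ← pow_mul, ← pow_mul,
      div_mul_cancel₀ _ (pow_ne_zero _ hx0), mul_comm A m, hAk]
    ring
  have hqA : (q ^ A).eval a ≠ 0 := by
    rw [eval_pow]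
    exact pow_ne_zero _ hq
  refine ⟨z, fun P hP => ?_⟩
  have hP' := (P.valuation_lt_one_iff_ord hx0).2 hP
  have hu := P.valuation_aeval_eq_one hP' hqA
  have hord : P.ord x = d * P.ord z := by
    have hu0 : aeval f (q ^ A) ≠ 0 := by
      intro h
      simp [h] at hu
    have := congrArg P.ord hzd
    rw [P.ord_pow hz0, P.ord_mul hx0 hu0, (P.valuation_eq_one_iff_ord hu0).1 hu, add_zero] at this
    exact this.symm
  have hzpos : 0 < P.ord z := by
    rw [hord] at hP
    exact pos_of_mul_pos_right hP (by positivity)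
  have hzlt := (P.valuation_lt_one_iff_ord hz0).2 hzpos
  have hfmem : f ∈ IntermediateField.adjoin ℂ {x, z} :=
    IntermediateField.mem_adjoin_of_sub_mem (c := a) (by simp [hx])
  have hxmem : x ∈ IntermediateField.adjoin ℂ {x, z} :=
    IntermediateField.subset_adjoin _ _ (by simp)
  have hzmem : z ∈ IntermediateField.adjoin ℂ {x, z} :=
    IntermediateField.subset_adjoin _ _ (by simp)
  have hzB : z ∈ Algebra.adjoin ℂ {x, z} := Algebra.subset_adjoin (by simp)
  have huB : aeval f (q ^ A) ∈ Algebra.adjoin ℂ {x, z} :=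
    aeval_mem_adjoin_of_sub_mem (c := a) (by simp [hx]) _
  refine ⟨⟨IntermediateField.adjoin_pair_eq_top_of_mem hgen hfmem ?_, hP', hzlt, hz0, hzB, hzlt,
    _, huB, hu, ⟨z ^ (d - 1), pow_mem hzB _, ?_⟩, ⟨_, huB, mul_comm _ _⟩⟩, hord⟩
  · rw [hyz]
    have hgmem : aeval f g ∈ IntermediateField.adjoin ℂ {x, z} :=
      Subalgebra.aeval_mem_of_mem (S := (IntermediateField.adjoin ℂ {x, z}).toSubalgebra) hfmem g
    exact div_mem (mul_mem (pow_mem hzmem _) (pow_mem hxmem _)) (pow_mem hgmem _)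
  · rw [mul_comm, ← hzd, ← pow_succ', Nat.sub_add_cancel hd.le]

end CurvePoint

/-! ### Kummer theory for `K` over `ℂ(f)`. -/

namespace IsCyclicCurve

variable {K : Type*} [Field K] [Algebra ℂ K] {d : ℕ} {f : K}

theorem finiteDimensional (hf : IsCyclicCurve d f) (hd : d.Prime) : FiniteDimensional ℂ⟮f⟯ K :=
  Module.finite_of_finrank_pos (by rw [hf.degree_eq]; exact hd.pos)

theorem adjoin_ne_top (hf : IsCyclicCurve d f) (hd : d.Prime) : ℂ⟮f⟯ ≠ ⊤ := by
  intro h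
  have h1 := hf.degree_eq
  rw [h, IntermediateField.finrank_top] at h1
  exact hd.one_lt.ne h1

theorem exists_pow_eq_aeval (hf : IsCyclicCurve d f) (hd : d.Prime) :
    ∃ (y : K) (g : ℂ[X]), g ≠ 0 ∧ y ^ d = aeval f g ∧ IntermediateField.adjoin ℂ {f, y} = ⊤ := by
  have := hf.finiteDimensional hd
  have := hf.isGalois
  have := hf.isCyclic
  have hprim : (primitiveRoots (Module.finrank ℂ⟮f⟯ K) ℂ⟮f⟯).Nonempty := by
    rw [hf.degree_eq]
    exact ⟨_, (mem_primitiveRoots hd.pos).2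
      ((Complex.isPrimitiveRoot_exp d hd.ne_zero).map_of_injective (algebraMap ℂ ℂ⟮f⟯).injective)⟩
  obtain ⟨α, ⟨⟨u, hu⟩, hα⟩, htop⟩ := exists_root_adjoin_eq_top_of_isCyclic ℂ⟮f⟯ K hprim
  rw [hf.degree_eq] at hα
  change u = α ^ d at hα
  have hgen : IntermediateField.adjoin ℂ {f, α} = ⊤ := by
    rw [← IntermediateField.adjoin_simple_adjoin_simple, htop,
      IntermediateField.restrictScalars_top]
  have hα0 : α ≠ 0 := by
    rintro rfl
    refine hf.adjoin_ne_top hd (eq_top_iff.2 ?_)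
    rw [← hgen, IntermediateField.adjoin_le_iff]
    rintro x (rfl | rfl)
    · exact IntermediateField.mem_adjoin_simple_self ℂ x
    · exact zero_mem _
  obtain ⟨r, s, hrs⟩ := (IntermediateField.mem_adjoin_simple_iff ℂ u).1 hu
  have hu0 : u ≠ 0 := hα ▸ pow_ne_zero d hα0
  have hr : r ≠ 0 := by
    rintro rfl
    exact hu0 (by simpa using hrs)
  have hs : s ≠ 0 := by
    rintro rfl
    exact hu0 (by simpa using hrs)
  have hs' := hf.transcendental.aeval_ne_zero hs
  -- Multiplying `α` by `s(f)` clears the denominator of `α ^ d = r(f) / s(f)`.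
  refine ⟨α * aeval f s, r * s ^ (d - 1), mul_ne_zero hr (pow_ne_zero _ hs), ?_, ?_⟩
  · rw [mul_pow, ← hα, hrs, map_mul, map_pow, div_mul_eq_mul_div, div_eq_iff hs', mul_assoc,
      ← pow_succ, Nat.sub_add_cancel hd.one_le]
  · have hfm : f ∈ IntermediateField.adjoin ℂ {f, α * aeval f s} :=
      IntermediateField.subset_adjoin _ _ (by simp)
    refine IntermediateField.adjoin_pair_eq_top_of_mem hgen hfm ?_
    have hαm : α * aeval f s ∈ IntermediateField.adjoin ℂ {f, α * aeval f s} :=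
      IntermediateField.subset_adjoin _ _ (by simp)
    have hsm : aeval f s ∈ IntermediateField.adjoin ℂ {f, α * aeval f s} :=
      Subalgebra.aeval_mem_of_mem
        (S := (IntermediateField.adjoin ℂ {f, α * aeval f s}).toSubalgebra) hfm s
    have := div_mem hαm hsm
    rwa [mul_div_cancel_right₀ α hs'] at this

/-- Kummer theory: a cyclic curve of prime degree `d` has an equation `y ^ d = g(f)` in which `g`
is free of `d`-th powers. -/
theorem exists_equation (hf : IsCyclicCurve d f) (hd : d.Prime) :
    ∃ (y : K) (g : ℂ[X]), g ≠ 0 ∧ y ^ d = aeval f g ∧ IntermediateField.adjoin ℂ {f, y} = ⊤ ∧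
      ∀ a, g.rootMultiplicity a < d := by
  have key : ∀ n : ℕ, ∀ (y : K) (g : ℂ[X]), g.natDegree = n → g ≠ 0 → y ^ d = aeval f g →
      IntermediateField.adjoin ℂ {f, y} = ⊤ → ∃ (y : K) (g : ℂ[X]), g ≠ 0 ∧ y ^ d = aeval f g ∧
        IntermediateField.adjoin ℂ {f, y} = ⊤ ∧ ∀ a, g.rootMultiplicity a < d := by
    intro n
    induction n using Nat.strong_induction_on with
    | _ n ih =>
      intro y g hn hg hy hgen
      by_cases hall : ∀ a, g.rootMultiplicity a < d
      · exact ⟨y, g, hg, hy, hgen, hall⟩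
      push Not at hall
      obtain ⟨a, ha⟩ := hall
      obtain ⟨q, hq⟩ := (le_rootMultiplicity_iff hg).1 ha
      have hq0 : q ≠ 0 := by
        rintro rfl
        exact hg (by simpa using hq)
      have hx := hf.transcendental.sub_algebraMap_ne_zero a
      -- Dividing `y` by `f - a` removes `(X - a) ^ d` from `g` and lowers the degree by `d`.
      refine ih q.natDegree ?_ (y / (f - algebraMap ℂ K a)) q rfl hq0 ?_ ?_
      · rw [← hn, hq, natDegree_mul (pow_ne_zero _ (X_sub_C_ne_zero a)) hq0, natDegree_pow,
          natDegree_X_sub_C, mul_one]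
        have := hd.pos
        omega
      · rw [div_pow, hy, hq, div_eq_iff (pow_ne_zero _ hx)]
        simp [mul_comm]
      · have hfm : f ∈ IntermediateField.adjoin ℂ {f, y / (f - algebraMap ℂ K a)} :=
          IntermediateField.subset_adjoin _ _ (by simp)
        refine IntermediateField.adjoin_pair_eq_top_of_mem hgen hfm ?_
        have hym : y / (f - algebraMap ℂ K a) ∈
            IntermediateField.adjoin ℂ {f, y / (f - algebraMap ℂ K a)} :=
          IntermediateField.subset_adjoin _ _ (by simp)
        have := mul_mem hym (sub_mem hfm (IntermediateField.algebraMap_mem _ a))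
        rwa [div_mul_cancel₀ y hx] at this
  obtain ⟨y, g, hg, hy, hgen⟩ := hf.exists_pow_eq_aeval hd
  exact key _ y g rfl hg hy hgen

/-- A generator `σ` of the Galois group multiplies `y` and `h` by `d`-th roots of unity. The one for
`y` is primitive, since `d` is prime and `y ∉ ℂ(f)`. So for some `k` the quotient `h / y ^ k` is
fixed by `σ`. -/
theorem exists_eq_pow_mul (hf : IsCyclicCurve d f) (hd : d.Prime) {y h : K} (hy0 : y ≠ 0)
    (hgen : IntermediateField.adjoin ℂ {f, y} = ⊤) (hy : y ^ d ∈ ℂ⟮f⟯) (hh0 : h ≠ 0)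
    (hh : h ^ d ∈ ℂ⟮f⟯) : ∃ k : ℕ, ∃ u ∈ ℂ⟮f⟯, h = y ^ k * u := by
  have := hf.finiteDimensional hd
  have := hf.isGalois
  obtain ⟨σ, hσ⟩ := hf.isCyclic
  have hfix : ∀ x : K, σ x = x → x ∈ ℂ⟮f⟯ := by
    intro x hx
    have hle : Subgroup.zpowers σ ≤ MulAction.stabilizer (K ≃ₐ[ℂ⟮f⟯] K) x := by
      rw [Subgroup.zpowers_le]
      exact hx
    obtain ⟨u, hu⟩ := IntermediateField.mem_bot.1
      ((IsGalois.mem_bot_iff_fixed (F := ℂ⟮f⟯) x).2 fun τ => hle (hσ τ))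
    rw [← hu]
    exact u.2
  have hpow : ∀ x : K, x ≠ 0 → x ^ d ∈ ℂ⟮f⟯ → (σ x / x) ^ d = 1 := by
    intro x hx hxd
    have h1 : σ (x ^ d) = x ^ d := σ.commutes ⟨x ^ d, hxd⟩
    rw [div_pow, ← map_pow, h1, div_self (pow_ne_zero d hx)]
  have hζ : σ y / y ≠ 1 := by
    rw [Ne, div_eq_one_iff_eq hy0]
    intro h1
    refine hf.adjoin_ne_top hd (eq_top_iff.2 ?_)
    rw [← hgen, IntermediateField.adjoin_le_iff]
    rintro x (rfl | rfl)
    · exact IntermediateField.mem_adjoin_simple_self ℂ x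
    · exact hfix x h1
  have : Fact d.Prime := ⟨hd⟩
  have hprim : IsPrimitiveRoot (σ y / y) d := by
    have := IsPrimitiveRoot.orderOf (σ y / y)
    rwa [orderOf_eq_prime (hpow y hy0 hy) hζ] at this
  have : NeZero d := ⟨hd.ne_zero⟩
  obtain ⟨k, -, hk⟩ := hprim.eq_pow_of_pow_eq_one (hpow h hh0 hh)
  refine ⟨k, h / y ^ k, hfix _ ?_, by field_simp⟩
  rw [map_div₀, map_pow]
  have hσy : σ y ≠ 0 := by simpa using hy0
  rw [div_pow, div_eq_div_iff (pow_ne_zero _ hy0) hh0] at hk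
  rw [div_eq_div_iff (pow_ne_zero _ hσy) (pow_ne_zero _ hy0), ← hk]
  ring

end IsCyclicCurve

/-! ### Ramification points as roots of `g`, and the orders of `y`. -/

/-- The curve is given by an equation `y ^ d = g(f)` of prime degree `d`, with `g` free of `d`-th
powers, and `f` is unramified over infinity. -/
structure IsCyclicEquation {K : Type*} [Field K] [Algebra ℂ K] (d : ℕ) (f y : K) (g : ℂ[X]) :
    Prop where
  prime : d.Prime
  transcendental : Transcendental ℂ f
  adjoin_ne_top : ℂ⟮f⟯ ≠ ⊤
  ne_zero : g ≠ 0
  pow_eq : y ^ d = aeval f g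
  gen : IntermediateField.adjoin ℂ {f, y} = ⊤
  rootMultiplicity_lt : ∀ a, g.rootMultiplicity a < d
  unramified : ∀ P : CurvePoint K, P.LiesOverInfinity f → ¬ P.IsRamified f

namespace IsCyclicEquation

variable {K : Type*} [Field K] [Algebra ℂ K] {d : ℕ} {f y : K} {g : ℂ[X]}

theorem y_ne_zero (h : IsCyclicEquation d f y g) : y ≠ 0 := by
  rintro rfl
  have := h.pow_eq
  rw [zero_pow h.prime.ne_zero] at this
  exact h.transcendental.aeval_ne_zero h.ne_zero this.symm

theorem y_pow_mem (h : IsCyclicEquation d f y g) : y ^ d ∈ ℂ⟮f⟯ := by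
  rw [h.pow_eq]
  exact Subalgebra.aeval_mem_of_mem (S := ℂ⟮f⟯.toSubalgebra)
    (IntermediateField.mem_adjoin_simple_self ℂ f) g

theorem mul_ord_y (h : IsCyclicEquation d f y g) (P : CurvePoint K) :
    d * P.ord y = P.ord (aeval f g) := by
  rw [← h.pow_eq, P.ord_pow h.y_ne_zero]

theorem ord_eq_neg_one_of_pole (h : IsCyclicEquation d f y g) {P : CurvePoint K}
    (hP : P.ord f < 0) : P.ord f = -1 := by
  have h1 : ¬ 2 ≤ P.ord f⁻¹ := fun h2 => h.unramified P hP (Or.inr h2)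
  rw [P.ord_inv] at h1
  omega

theorem not_pole_of_isRamified (h : IsCyclicEquation d f y g) {P : CurvePoint K}
    (hP : P.IsRamified f) : ¬ P.ord f < 0 := fun h1 => h.unramified P h1 hP

theorem isLocalGenerator (h : IsCyclicEquation d f y g) {a : ℂ} (ha : g.IsRoot a) :
    ∃ z : K, ∀ P : CurvePoint K, 0 < P.ord (f - algebraMap ℂ K a) →
      P.IsLocalGenerator (f - algebraMap ℂ K a) z z ∧
      P.ord (f - algebraMap ℂ K a) = d * P.ord z :=
  CurvePoint.exists_isLocalGenerator h.transcendental h.prime.one_lt h.gen h.pow_eq h.ne_zero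
    (Nat.coprime_of_lt_prime ((rootMultiplicity_pos h.ne_zero).2 ha).ne'
      (h.rootMultiplicity_lt a) h.prime).symm

theorem ord_sub_of_isRoot (h : IsCyclicEquation d f y g) {a : ℂ} (ha : g.IsRoot a)
    {P : CurvePoint K} (hP : 0 < P.ord (f - algebraMap ℂ K a)) :
    P.ord (f - algebraMap ℂ K a) = d := by
  obtain ⟨z, hz⟩ := h.isLocalGenerator ha
  rw [(hz P hP).2, (hz P hP).1.ord_eq_one, mul_one]

/-- The same `z` is a local generator at every point over `a`, which forces the points to coincide.
-/
theorem eq_of_isRoot (h : IsCyclicEquation d f y g) {a : ℂ} (ha : g.IsRoot a)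
    {P Q : CurvePoint K} (hP : 0 < P.ord (f - algebraMap ℂ K a))
    (hQ : 0 < Q.ord (f - algebraMap ℂ K a)) : P = Q := by
  obtain ⟨z, hz⟩ := h.isLocalGenerator ha
  exact (hz P hP).1.eq (hz Q hQ).1

theorem isRamified_iff (h : IsCyclicEquation d f y g) {P : CurvePoint K} :
    P.IsRamified f ↔ ∃ a, g.IsRoot a ∧ 0 < P.ord (f - algebraMap ℂ K a) := by
  constructor
  · intro hP
    rcases id hP with ⟨c, hc⟩ | hc
    · refine ⟨c, ?_, by omega⟩
      by_contra hg
      have := CurvePoint.ord_sub_of_not_isRoot h.transcendental h.prime.ne_zero h.gen h.pow_eq hg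
        (by omega : 0 < P.ord (f - algebraMap ℂ K c))
      omega
    · refine absurd hP (h.unramified P ?_)
      rw [P.ord_inv] at hc
      change P.ord f < 0
      omega
  · rintro ⟨a, ha, hP⟩
    refine Or.inl ⟨a, ?_⟩
    rw [h.ord_sub_of_isRoot ha hP]
    exact_mod_cast h.prime.two_le

theorem ord_y_of_isRoot (h : IsCyclicEquation d f y g) {a : ℂ} (ha : g.IsRoot a)
    {P : CurvePoint K} (hP : 0 < P.ord (f - algebraMap ℂ K a)) :
    P.ord y = g.rootMultiplicity a := by
  have h1 := h.mul_ord_y P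
  rw [P.ord_aeval_of_zero h.transcendental hP h.ne_zero, h.ord_sub_of_isRoot ha hP, mul_comm] at h1
  exact mul_right_cancel₀ (by exact_mod_cast h.prime.ne_zero) h1

theorem ord_y_of_isRamified (h : IsCyclicEquation d f y g) {P : CurvePoint K}
    (hP : P.IsRamified f) : 0 < P.ord y ∧ P.ord y < d := by
  obtain ⟨a, ha, hPa⟩ := h.isRamified_iff.1 hP
  rw [h.ord_y_of_isRoot ha hPa]
  exact ⟨by exact_mod_cast (rootMultiplicity_pos h.ne_zero).2 ha,
    by exact_mod_cast h.rootMultiplicity_lt a⟩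

theorem mul_ord_y_of_pole (h : IsCyclicEquation d f y g) {P : CurvePoint K} (hP : P.ord f < 0) :
    d * P.ord y = -g.natDegree := by
  rw [h.mul_ord_y, P.ord_aeval_of_pole h.transcendental hP h.ne_zero, h.ord_eq_neg_one_of_pole hP]
  ring

section

variable [hK : IsCurveFunctionField K]

theorem ord_y_of_not_isRamified (h : IsCyclicEquation d f y g) {P : CurvePoint K}
    (hP : ¬ P.IsRamified f) (hinf : ¬ P.ord f < 0) : P.ord y = 0 := by
  have := IsCurveFunctionField.finiteDimensional_adjoin h.transcendental
  obtain ⟨c, hc⟩ := (P.pole_or_exists_zero h.transcendental).resolve_left hinf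
  have hg : ¬ g.IsRoot c := fun hg => hP (h.isRamified_iff.2 ⟨c, hg, hc⟩)
  have h1 := h.mul_ord_y P
  rw [P.ord_aeval_of_zero h.transcendental hc h.ne_zero, rootMultiplicity_eq_zero hg] at h1
  simpa [h.prime.ne_zero] using h1

theorem exists_point (h : IsCyclicEquation d f y g) (a : ℂ) :
    ∃ P : CurvePoint K, 0 < P.ord (f - algebraMap ℂ K a) :=
  CurvePoint.exists_ord_pos fun ha => h.transcendental
    (by simpa using ha.add (isAlgebraic_algebraMap a))

theorem exists_pole (h : IsCyclicEquation d f y g) : ∃ P : CurvePoint K, P.ord f < 0 := by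
  obtain ⟨P, hP⟩ := CurvePoint.exists_ord_pos (h := f⁻¹) fun ha => h.transcendental
    (by simpa using ha.inv)
  rw [P.ord_inv] at hP
  exact ⟨P, by omega⟩

/-- The ramification points correspond to the roots of `g`. -/
theorem exists_bijOn (h : IsCyclicEquation d f y g) : ∃ p : ℂ → CurvePoint K,
    Set.BijOn p {a | g.IsRoot a} (ramificationPoints f) ∧
    ∀ a, 0 < (p a).ord (f - algebraMap ℂ K a) := by
  choose p hp using h.exists_point
  refine ⟨p, ⟨fun a ha => h.isRamified_iff.2 ⟨a, ha, hp a⟩, ?_, ?_⟩, hp⟩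
  · intro a _ b _ hab
    by_contra hne
    have h1 := hp a
    have h2 := (p b).ord_sub_algebraMap_of_zero h.transcendental (hp b) hne
    rw [hab, h2] at h1
    exact lt_irrefl _ h1
  · intro P hP
    obtain ⟨a, ha, hPa⟩ := h.isRamified_iff.1 hP
    exact ⟨a, ha, h.eq_of_isRoot ha (hp a) hPa⟩

theorem finite_ramificationPoints (h : IsCyclicEquation d f y g) :
    (ramificationPoints f).Finite := by
  obtain ⟨p, hp, -⟩ := h.exists_bijOn
  rw [← hp.image_eq]
  refine Set.Finite.image p ((g.roots.toFinset.finite_toSet).subset fun a ha => ?_)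
  simpa [h.ne_zero] using ha

theorem sum_ord_y (h : IsCyclicEquation d f y g) :
    ∑ P ∈ h.finite_ramificationPoints.toFinset, P.ord y = g.natDegree := by
  classical
  obtain ⟨p, hp, hpa⟩ := h.exists_bijOn
  rw [← splits_iff_card_roots.1 (IsAlgClosed.splits g), ← Multiset.toFinset_sum_count_eq]
  push_cast
  symm
  refine Finset.sum_bij (fun a _ => p a) ?_ ?_ ?_ ?_
  · intro a ha
    rw [Set.Finite.mem_toFinset]
    exact hp.mapsTo (by simpa [h.ne_zero] using ha)
  · intro a ha b hb hab
    exact hp.injOn (by simpa [h.ne_zero] using ha) (by simpa [h.ne_zero] using hb) hab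
  · intro P hP
    obtain ⟨a, ha, rfl⟩ := hp.surjOn ((Set.Finite.mem_toFinset _).1 hP)
    exact ⟨a, by simpa [h.ne_zero] using ha, rfl⟩
  · intro a ha
    rw [count_roots, h.ord_y_of_isRoot (by simpa [h.ne_zero] using ha) (hpa a)]

/-- The sum is the degree of `g`, which equals `-d * ord y` at any pole of `f` because that pole is
simple. -/
theorem dvd_sum_ord_y (h : IsCyclicEquation d f y g) :
    (d : ℤ) ∣ ∑ P ∈ h.finite_ramificationPoints.toFinset, P.ord y := by
  obtain ⟨P, hP⟩ := h.exists_pole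
  rw [h.sum_ord_y, ← dvd_neg]
  exact ⟨_, (h.mul_ord_y_of_pole hP).symm⟩

theorem two_le_ncard (h : IsCyclicEquation d f y g) : 2 ≤ (ramificationPoints f).ncard := by
  have hdvd := h.dvd_sum_ord_y
  rw [Set.ncard_eq_toFinset_card _ h.finite_ramificationPoints]
  by_contra! hlt
  have hcases : h.finite_ramificationPoints.toFinset.card = 0 ∨
    h.finite_ramificationPoints.toFinset.card = 1 := by omega
  -- With no ramification point, `y` has no zeros and is constant, against `ℂ(f) ≠ K`. With a single
  -- one, `d` would divide an order strictly between `0` and `d`.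
  rcases hcases with h0 | h1
  · rw [Finset.card_eq_zero] at h0
    have hdeg := h.sum_ord_y
    rw [h0, Finset.sum_empty] at hdeg
    have hram : ∀ P : CurvePoint K, ¬ P.IsRamified f := by
      intro P hP
      have : P ∈ h.finite_ramificationPoints.toFinset := (Set.Finite.mem_toFinset _).2 hP
      simp [h0] at this
    obtain ⟨c, hc⟩ := exists_eq_algebraMap_of_ord_nonpos (h := y) fun P => by
      by_cases hP : P.ord f < 0
      · have := h.mul_ord_y_of_pole hP
        rw [← hdeg] at this
        have hd := h.prime.ne_zero
        simp [hd] at this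
        exact this.le
      · exact (h.ord_y_of_not_isRamified (hram P) hP).le
    refine h.adjoin_ne_top (eq_top_iff.2 ?_)
    rw [← h.gen, IntermediateField.adjoin_le_iff]
    rintro x (rfl | rfl)
    · exact IntermediateField.mem_adjoin_simple_self ℂ x
    · rw [hc]
      exact IntermediateField.algebraMap_mem _ c
  · obtain ⟨P, hP⟩ := Finset.card_eq_one.1 h1
    have hPR : P.IsRamified f := by
      have : P ∈ h.finite_ramificationPoints.toFinset := by simp [hP]
      exact (Set.Finite.mem_toFinset h.finite_ramificationPoints).1 this
    rw [hP, Finset.sum_singleton] at hdvd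
    have h2 := h.ord_y_of_isRamified hPR
    exact absurd (Int.le_of_dvd h2.1 hdvd) (by omega)

end

end IsCyclicEquation

/-! ### Counting and lifting vectors of sum zero modulo `d`. -/

theorem AddSubgroup.relIndex_zmultiples_ker_sum {d : ℕ} (hd : d.Prime) {R : Type*} [Fintype R]
    (hR : 2 ≤ Fintype.card R) {m : R → ZMod d} (hm : m ≠ 0) {V : AddSubgroup (R → ZMod d)}
    (hV : ∀ v, v ∈ V ↔ ∑ i, v i = 0) (hmV : m ∈ V) :
    (AddSubgroup.zmultiples m).relIndex V = d ^ (Fintype.card R - 2) := by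
  classical
  have : Fact d.Prime := ⟨hd⟩
  let s : (R → ZMod d) →+ ZMod d :=
    { toFun := fun v => ∑ i, v i
      map_zero' := by simp
      map_add' := fun v w => by simp [Finset.sum_add_distrib] }
  have hVs : V = s.ker := by
    ext v
    rw [hV]
    rfl
  have hs : Function.Surjective s := by
    intro c
    have : Nonempty R := Fintype.card_pos_iff.1 (by omega)
    obtain ⟨i⟩ := this
    exact ⟨Pi.single i c, by simp [s]⟩
  have hindex : V.index = d := by
    rw [hVs, AddSubgroup.index_ker, AddMonoidHom.range_eq_top.2 hs]
    simp
  have hcardV : Nat.card V * d = d ^ Fintype.card R := by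
    have := V.card_mul_index
    rw [hindex] at this
    rw [this]
    simp
  have hcardL : Nat.card (AddSubgroup.zmultiples m) = d := by
    rw [Nat.card_zmultiples]
    refine addOrderOf_eq_prime ?_ hm
    ext i
    simp
  have hrel := AddSubgroup.relIndex_mul_relIndex ⊥ (AddSubgroup.zmultiples m) V bot_le
    ((AddSubgroup.zmultiples_le_of_mem) hmV)
  rw [AddSubgroup.relIndex_bot_left, AddSubgroup.relIndex_bot_left, hcardL] at hrel
  rw [← hrel] at hcardV
  have hpow : d ^ Fintype.card R = d * d ^ (Fintype.card R - 2) * d := by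
    obtain ⟨n, hn⟩ := Nat.exists_eq_add_of_le hR
    rw [hn, Nat.add_sub_cancel_left, pow_add]
    ring
  rw [hpow] at hcardV
  exact Nat.eq_of_mul_eq_mul_left hd.pos (Nat.eq_of_mul_eq_mul_right hd.pos hcardV)

/-- A function with values in `ZMod d` and sum zero lifts to an integral function with sum zero. -/
theorem ZMod.exists_int_lift_sum_eq_zero {d : ℕ} {R : Type*} [Fintype R] {v : R → ZMod d}
    (hv : ∑ i, v i = 0) : ∃ n : R → ℤ, ∑ i, n i = 0 ∧ ∀ i, (n i : ZMod d) = v i := by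
  classical
  choose n hn using fun i => ZMod.intCast_surjective (v i)
  have hdvd : (d : ℤ) ∣ ∑ i, n i := by
    rw [← ZMod.intCast_zmod_eq_zero_iff_dvd]
    push_cast
    simpa [hn] using hv
  rcases isEmpty_or_nonempty R with hR | ⟨⟨j⟩⟩
  · exact ⟨n, by simp, hn⟩
  -- The total of any lift is divisible by `d`, so it can be subtracted from one coordinate.
  · refine ⟨n - Pi.single j (∑ i, n i), by simp, fun i => ?_⟩
    have h0 : ((∑ i, n i : ℤ) : ZMod d) = 0 := (ZMod.intCast_zmod_eq_zero_iff_dvd _ _).2 hdvd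
    by_cases hij : i = j
    · subst hij
      rw [Pi.sub_apply, Pi.single_eq_same, Int.cast_sub, h0, sub_zero, hn]
    · simp [hij, hn]

/-! ### Which divisors on the ramification points are principal. -/

namespace IsCyclicEquation

variable {K : Type*} [Field K] [Algebra ℂ K] {d : ℕ} {f y : K} {g : ℂ[X]}

/-- At the point over a root `a`, the function `f - a` has order `d` and every other `f - b` has
order zero. -/
theorem dvd_ord_of_mem (h : IsCyclicEquation d f y g) {P : CurvePoint K} (hP : P.IsRamified f)
    {u : K} (hu : u ∈ ℂ⟮f⟯) (hu0 : u ≠ 0) : (d : ℤ) ∣ P.ord u := by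
  obtain ⟨r, s, rfl⟩ := (IntermediateField.mem_adjoin_simple_iff ℂ u).1 hu
  have hr : r ≠ 0 := by rintro rfl; simp at hu0
  have hs : s ≠ 0 := by rintro rfl; simp at hu0
  obtain ⟨a, ha, hPa⟩ := h.isRamified_iff.1 hP
  rw [P.ord_div (h.transcendental.aeval_ne_zero hr) (h.transcendental.aeval_ne_zero hs),
    P.ord_aeval_of_zero h.transcendental hPa hr, P.ord_aeval_of_zero h.transcendental hPa hs,
    h.ord_sub_of_isRoot ha hPa]
  exact dvd_sub (dvd_mul_left _ _) (dvd_mul_left _ _)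

theorem apply_eq_zero (D : CurveDivisor K) (hD : ↑D.support ⊆ ramificationPoints f)
    {P : CurvePoint K} (hP : ¬ P.IsRamified f) : D P = 0 := by
  by_contra hne
  exact hP (hD (Finsupp.mem_support_iff.2 hne))

variable [hK : IsCurveFunctionField K]

/-- The function is the product of the `(f - f(P)) ^ D(P)`. Each `f - f(P)` vanishes only at `P`, to
order `d`, and has simple poles exactly at the poles of `f`. -/
theorem exists_function_of_divisor (h : IsCyclicEquation d f y g) (D : CurveDivisor K)
    (hD : ↑D.support ⊆ ramificationPoints f) :
    ∃ F ∈ ℂ⟮f⟯, F ≠ 0 ∧ ∀ Q : CurvePoint K, (Q.ord f < 0 → Q.ord F = -D.degree) ∧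
      (¬ Q.ord f < 0 → Q.ord F = d * D Q) := by
  have hch : ∀ P : CurvePoint K, ∃ c : ℂ, P.IsRamified f →
      g.IsRoot c ∧ 0 < P.ord (f - algebraMap ℂ K c) := by
    intro P
    by_cases hP : P.IsRamified f
    · obtain ⟨c, hc⟩ := h.isRamified_iff.1 hP
      exact ⟨c, fun _ => hc⟩
    · exact ⟨0, fun h1 => absurd h1 hP⟩
  choose c hc using hch
  have hx := fun P => h.transcendental.sub_algebraMap_ne_zero (c P)
  refine ⟨∏ P ∈ D.support, (f - algebraMap ℂ K (c P)) ^ D P, ?_, ?_, fun Q => ?_⟩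
  · exact prod_mem fun P _ => zpow_mem (sub_mem (IntermediateField.mem_adjoin_simple_self ℂ f)
      (IntermediateField.algebraMap_mem _ _)) _
  · exact Finset.prod_ne_zero_iff.2 fun P _ => zpow_ne_zero _ (hx P)
  · rw [Q.ord_prod _ _ fun P _ => zpow_ne_zero _ (hx P)]
    simp only [Q.ord_zpow (hx _)]
    constructor
    · intro hQ
      simp [Q.ord_sub_algebraMap_of_pole hQ, h.ord_eq_neg_one_of_pole hQ, Finsupp.degree_apply]
    · intro hQ
      have := IsCurveFunctionField.finiteDimensional_adjoin h.transcendental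
      obtain ⟨b, hb⟩ := (Q.pole_or_exists_zero h.transcendental).resolve_left hQ
      rw [Finset.sum_eq_single Q]
      · by_cases hQR : Q.IsRamified f
        · rw [h.ord_sub_of_isRoot (hc Q hQR).1 (hc Q hQR).2, mul_comm]
        · have : D Q = 0 := by
            by_contra hne
            exact hQR (hD (Finsupp.mem_support_iff.2 hne))
          simp [this]
      · intro P hP hPQ
        have hPR := hc P (hD hP)
        have hne : c P ≠ b := by
          rintro rfl
          exact hPQ (h.eq_of_isRoot hPR.1 hPR.2 hb)
        rw [Q.ord_sub_algebraMap_of_zero h.transcendental hb hne, mul_zero]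
      · intro hQ'
        rw [Finsupp.notMem_support_iff.1 hQ', zero_mul]

theorem degree_eq_sum (h : IsCyclicEquation d f y g) (D : CurveDivisor K)
    (hD : ↑D.support ⊆ ramificationPoints f) :
    D.degree = ∑ P ∈ h.finite_ramificationPoints.toFinset, D P := by
  rw [Finsupp.degree_apply]
  refine Finset.sum_subset (fun P hP => (Set.Finite.mem_toFinset _).2 (hD hP)) fun P _ hP => ?_
  exact Finsupp.notMem_support_iff.1 hP

/-- A divisor of degree zero supported on the ramification points is principal if and only if it is
congruent modulo `d` to a multiple of the divisor of `y`. -/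
theorem mem_principalDivisors_iff (hf : IsCyclicCurve d f) (h : IsCyclicEquation d f y g)
    (D : CurveDivisor K) (hD : ↑D.support ⊆ ramificationPoints f) (hdeg : D.degree = 0) :
    D ∈ principalDivisors K ↔
      ∃ k : ℤ, ∀ P ∈ ramificationPoints f, (d : ℤ) ∣ D P - k * P.ord y := by
  classical
  have hd0 : (d : ℤ) ≠ 0 := by exact_mod_cast h.prime.ne_zero
  constructor
  · rintro ⟨w, hw0, hw⟩
    obtain ⟨F, hF, hF0, hFD⟩ := h.exists_function_of_divisor D hD
    -- Both `w ^ d` and `F` have divisor `d D`; at the poles of `f` this uses that `D` has degree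
    -- zero.
    obtain ⟨c, hc⟩ := exists_eq_algebraMap_of_ord_nonpos (h := w ^ d / F) fun P => by
      rw [P.ord_div (pow_ne_zero _ hw0) hF0, P.ord_pow hw0, ← hw]
      by_cases hP : P.ord f < 0
      · rw [(hFD P).1 hP, hdeg, apply_eq_zero D hD fun h1 => h.not_pole_of_isRamified h1 hP]
        simp
      · rw [(hFD P).2 hP, sub_self]
    have hwd : w ^ d ∈ ℂ⟮f⟯ := by
      rw [div_eq_iff hF0] at hc
      rw [hc]
      exact mul_mem (IntermediateField.algebraMap_mem _ c) hF
    obtain ⟨k, u, hu, hwu⟩ :=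
      hf.exists_eq_pow_mul h.prime h.y_ne_zero h.gen h.y_pow_mem hw0 hwd
    have hu0 : u ≠ 0 := by
      rintro rfl
      exact hw0 (by simpa using hwu)
    refine ⟨k, fun P hP => ?_⟩
    rw [hw P, hwu, P.ord_mul (pow_ne_zero _ h.y_ne_zero) hu0, P.ord_pow h.y_ne_zero,
      add_sub_cancel_left]
    exact h.dvd_ord_of_mem hP hu hu0
  · rintro ⟨k, hk⟩
    -- `E` is `(D - k * div y) / d` on the ramification points, so that `y ^ k` times the function
    -- of `E` has the orders of `D` there.
    let E : CurveDivisor K := Finsupp.onFinset h.finite_ramificationPoints.toFinset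
      (fun P => if P.IsRamified f then (D P - k * P.ord y) / d else 0) fun P hP => by
        by_contra hne
        have : ¬ P.IsRamified f := fun h1 => hne ((Set.Finite.mem_toFinset _).2 h1)
        simp [this] at hP
    have hE : ∀ P, P.IsRamified f → d * E P = D P - k * P.ord y := by
      intro P hP
      simp only [E, Finsupp.onFinset_apply, if_pos hP]
      exact Int.mul_ediv_cancel' (hk P hP)
    have hEs : ↑E.support ⊆ ramificationPoints f := by
      intro P hP
      by_contra hne
      exact (Finsupp.mem_support_iff.1 hP) (if_neg hne)
    have hEdeg : d * E.degree = -k * g.natDegree := by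
      rw [h.degree_eq_sum E hEs, Finset.mul_sum,
        Finset.sum_congr rfl fun P hP => hE P ((Set.Finite.mem_toFinset
          h.finite_ramificationPoints).1 hP),
        Finset.sum_sub_distrib, ← h.degree_eq_sum D hD, hdeg, ← Finset.mul_sum, h.sum_ord_y]
      ring
    obtain ⟨F, -, hF0, hFE⟩ := h.exists_function_of_divisor E hEs
    refine ⟨y ^ k * F, mul_ne_zero (zpow_ne_zero _ h.y_ne_zero) hF0, fun P => ?_⟩
    rw [P.ord_mul (zpow_ne_zero _ h.y_ne_zero) hF0, P.ord_zpow h.y_ne_zero]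
    by_cases hP : P.ord f < 0
    · rw [(hFE P).1 hP, apply_eq_zero D hD fun h1 => h.not_pole_of_isRamified h1 hP]
      -- After multiplication by `d`, the contributions of `y ^ k` and `F` at a pole are `-k * deg
      -- g` and `k * deg g`.
      refine mul_left_cancel₀ hd0 ?_
      have := h.mul_ord_y_of_pole hP
      linear_combination hEdeg - k * this
    · rw [(hFE P).2 hP]
      by_cases hPR : P.IsRamified f
      · rw [hE P hPR]
        ring
      · rw [apply_eq_zero D hD hPR, apply_eq_zero E hEs hPR, h.ord_y_of_not_isRamified hPR hP]
        ring

end IsCyclicEquation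

/-! ### The group of ramification classes and its order. -/

namespace IsCyclicEquation

variable {K : Type*} [Field K] [Algebra ℂ K] {d : ℕ} {f y : K} {g : ℂ[X]}

/-- The divisors of degree zero supported on the ramification points. -/
noncomputable def ramificationDivisors (f : K) : AddSubgroup (divisorsDegZero K) where
  carrier := {D | ↑(D : CurveDivisor K).support ⊆ ramificationPoints f}
  zero_mem' := by simp
  add_mem' := by
    intro D E hD hE P hP
    by_contra hne
    rw [SetLike.mem_coe, Finsupp.mem_support_iff] at hP
    refine hP ?_
    change (D : CurveDivisor K) P + (E : CurveDivisor K) P = 0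
    rw [apply_eq_zero _ hD hne, apply_eq_zero _ hE hne, add_zero]
  neg_mem' := by
    intro D hD P hP
    refine hD ?_
    simpa using hP

theorem degree_coe (D : divisorsDegZero K) : (D : CurveDivisor K).degree = 0 := D.2

/-- The coefficients of a divisor at the ramification points, modulo `d`. -/
noncomputable def coeffMod (d : ℕ) (f : K) : ramificationDivisors f →+ (ramificationPoints f → ZMod d) where
  toFun D P := (((D : divisorsDegZero K) : CurveDivisor K) P : ZMod d)
  map_zero' := by
    ext P
    simp
  map_add' D E := by
    ext P
    simp

theorem ramificationClasses_eq (f : K) : ramificationClasses f =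
    ((ramificationDivisors f).map (QuotientAddGroup.mk'
      ((principalDivisors K).addSubgroupOf (divisorsDegZero K))) : Set (CurveJacobian K)) :=
  rfl

variable [hK : IsCurveFunctionField K]

theorem mem_range_coeffMod_iff (h : IsCyclicEquation d f y g) [Fintype (ramificationPoints f)]
    (v : ramificationPoints f → ZMod d) : v ∈ (coeffMod d f).range ↔ ∑ P, v P = 0 := by
  classical
  constructor
  · rintro ⟨D, rfl⟩
    have h1 := h.degree_eq_sum _ D.2
    rw [degree_coe, Finset.sum_subtype h.finite_ramificationPoints.toFinset
      (p := (· ∈ ramificationPoints f)) (fun P => Set.Finite.mem_toFinset _)] at h1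
    have h2 := congrArg (Int.cast : ℤ → ZMod d) h1
    push_cast at h2
    exact h2.symm
  · intro hv
    obtain ⟨n, hn, hnv⟩ := ZMod.exists_int_lift_sum_eq_zero hv
    let D : CurveDivisor K := ∑ P : ramificationPoints f, Finsupp.single (P : CurvePoint K) (n P)
    have hDdeg : D.degree = 0 := by simp [D, hn]
    have hDP : ∀ P : ramificationPoints f, D P = n P := by
      intro P
      simp [D, Finsupp.finsetSum_apply, Finsupp.single_apply, Subtype.coe_inj]
    have hDs : ↑D.support ⊆ ramificationPoints f := by
      intro Q hQ
      by_contra hne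
      refine Finsupp.mem_support_iff.1 hQ ?_
      simp only [D, Finsupp.finsetSum_apply]
      refine Finset.sum_eq_zero fun P _ => Finsupp.single_eq_of_ne ?_
      rintro rfl
      exact hne P.2
    refine ⟨⟨⟨D, hDdeg⟩, hDs⟩, ?_⟩
    ext P
    rw [← hnv P, ← hDP P]
    rfl

theorem addSubgroupOf_eq_comap (hf : IsCyclicCurve d f) (h : IsCyclicEquation d f y g) :
    ((principalDivisors K).addSubgroupOf (divisorsDegZero K)).addSubgroupOf
      (ramificationDivisors f) =
    (AddSubgroup.zmultiples fun P : ramificationPoints f =>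
      ((P : CurvePoint K).ord y : ZMod d)).comap (coeffMod d f) := by
  ext D
  rw [AddSubgroup.mem_addSubgroupOf, AddSubgroup.mem_addSubgroupOf, AddSubgroup.mem_comap,
    h.mem_principalDivisors_iff hf _ D.2 (degree_coe _), AddSubgroup.mem_zmultiples_iff]
  refine exists_congr fun k => ?_
  rw [funext_iff, Subtype.forall]
  refine forall₂_congr fun P hP => ?_
  rw [← ZMod.intCast_zmod_eq_zero_iff_dvd, Int.cast_sub, sub_eq_zero, eq_comm]
  simp [coeffMod]

/-- The number of classes is the index of the principal divisors among the ramification divisors.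
Since the principal ones are the preimage under `coeffMod` of the line spanned by the orders of `y`,
this is the index of that line in the sum-zero hyperplane. -/
theorem ncard_ramificationClasses (hf : IsCyclicCurve d f) (h : IsCyclicEquation d f y g) :
    (ramificationClasses f).ncard = d ^ ((ramificationPoints f).ncard - 2) := by
  classical
  have := h.finite_ramificationPoints.fintype
  have hcard : (ramificationPoints f).ncard = Fintype.card (ramificationPoints f) := by
    rw [← Nat.card_coe_set_eq, Nat.card_eq_fintype_card]
  have hR := h.two_le_ncard
  rw [hcard] at hR ⊢
  have h1 : (ramificationClasses f).ncard =
      ((principalDivisors K).addSubgroupOf (divisorsDegZero K)).relIndex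
        (ramificationDivisors f) := by
    rw [ramificationClasses_eq, ← Nat.card_coe_set_eq]
    have := AddSubgroup.relIndex_ker (ramificationDivisors f) (QuotientAddGroup.mk'
      ((principalDivisors K).addSubgroupOf (divisorsDegZero K)))
    rw [QuotientAddGroup.ker_mk'] at this
    exact this.symm
  rw [h1, AddSubgroup.relIndex, h.addSubgroupOf_eq_comap hf, AddSubgroup.index_comap]
  refine AddSubgroup.relIndex_zmultiples_ker_sum h.prime hR ?_ h.mem_range_coeffMod_iff ?_
  -- The spanning vector is nonzero because its entries are residues of integers strictly between
  -- `0` and `d`.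
  · intro h0
    obtain ⟨P⟩ : Nonempty (ramificationPoints f) := Fintype.card_pos_iff.1 (by omega)
    have h2 := congrFun h0 P
    have h3 := h.ord_y_of_isRamified P.2
    exact absurd (Int.le_of_dvd h3.1 ((ZMod.intCast_zmod_eq_zero_iff_dvd _ _).1 h2)) (by omega)
  · rw [h.mem_range_coeffMod_iff]
    have h2 := h.dvd_sum_ord_y
    rw [← ZMod.intCast_zmod_eq_zero_iff_dvd, Finset.sum_subtype
      h.finite_ramificationPoints.toFinset (p := (· ∈ ramificationPoints f))
      (fun P => Set.Finite.mem_toFinset _)] at h2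
    exact_mod_cast h2

theorem smul_mem_principalDivisors (hf : IsCyclicCurve d f) (h : IsCyclicEquation d f y g)
    (D : CurveDivisor K) (hD : ↑D.support ⊆ ramificationPoints f) (hdeg : D.degree = 0) :
    (d : ℤ) • D ∈ principalDivisors K := by
  refine (h.mem_principalDivisors_iff hf _ ?_ ?_).2 ⟨0, fun P _ => ?_⟩
  · exact fun P hP => hD (Finsupp.support_smul hP)
  · rw [map_zsmul, hdeg, smul_zero]
  · simp

end IsCyclicEquation

theorem mainTheorem2 {K : Type*} [Field K] [Algebra ℂ K] [IsCurveFunctionField K]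
    (d : ℕ) (hd : d.Prime) (f : K) (hf : IsCyclicCurve d f)
    (hinf : ∀ P : CurvePoint K, P.LiesOverInfinity f → ¬ P.IsRamified f) :
    (ramificationPoints f).Finite ∧ 2 ≤ (ramificationPoints f).ncard ∧
      (∀ c ∈ ramificationClasses f, c ∈ AddSubgroup.torsionBy (CurveJacobian K) (d : ℤ)) ∧
      (ramificationClasses f).Finite ∧
      (ramificationClasses f).ncard = d ^ ((ramificationPoints f).ncard - 2) := by
  obtain ⟨y, g, hg, hy, hgen, hlt⟩ := hf.exists_equation hd
  have h : IsCyclicEquation d f y g :=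
    ⟨hd, hf.transcendental, hf.adjoin_ne_top hd, hg, hy, hgen, hlt, hinf⟩
  have hcard := h.ncard_ramificationClasses hf
  refine ⟨h.finite_ramificationPoints, h.two_le_ncard, ?_, ?_, hcard⟩
  · rintro _ ⟨D, hD, rfl⟩
    change (d : ℤ) • (QuotientAddGroup.mk D : CurveJacobian K) = 0
    rw [← QuotientAddGroup.mk_zsmul, QuotientAddGroup.eq_zero_iff, AddSubgroup.mem_addSubgroupOf]
    exact h.smul_mem_principalDivisors hf D hD D.2
  -- An infinite set would have `ncard` zero, whereas a power of `d` is not zero.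
  · exact Set.finite_of_ncard_ne_zero (hcard ▸ pow_ne_zero _ hd.ne_zero)
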